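/- Let $d\ge 2$, $G=\mathrm{SL}(d,\mathbb R)$, $K=\mathrm{SO}(d)$, let $\mathfrak a=\{Y\in\mathbb R^d:\sum_i Y_i=0\}$ (identified with the trace-zero real diagonal matrices) with the norm $\|\cdot\|$ given by the Killing form, $A=\exp\mathfrak a$, $\mathfrak a^{++}=\{Y\in\mathfrak a: Y_1>\dots>Y_d\}$, and $M=Z_K(A)$. Let $\Gamma$ be a finite index subgroup of $\mathrm{SL}(d,\mathbb Z)$. For a point $z=\Gamma gM$ of $\Gamma\backslash G/M$ let $s(z)$ be the smallest Euclidean norm of a nonzero vector of the lattice $\mathbb Z^dg$ of row vectors, and put $\Omega(R)=\{z: 1/s(z)\le R\}$ and $\Omega(R_1,R_2)=\{z: R_1<1/s(z)\le R_2\}$. An element of $G$ is loxodromic if its Jordan projection $\lambda(\gamma)$ lies in $\mathfrak a^{++}$; for $\gamma\in\Gamma$ loxodromic, let $F_{[\gamma]}=\Gamma gAM\subset\Gamma\backslash G/M$, where $g\in G$ is any element such that $g^{-1}\gamma g\in\exp(\lambda(\gamma))M$. Let $\Gamma^{lox}_c$ be the set of loxodromic $\gamma\in\Gamma$ such that the $A$-orbit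 $F=F_{[\gamma]}$ is compact periodic, i.e. such that $\Lambda(F)=\{Y\in\mathfrak a: ze^Y=z\text{ for all }z\in F\}$ is a lattice in $\mathfrak a$, and let $\mathrm{Leb}$ denote the measure on $F\simeq\mathfrak a/\Lambda(F)$ that is the quotient of the Lebesgue measure of $\mathfrak a$. Theorem. For every $\vartheta>0$ there exist constants $C,C'>0$, depending only on $d$, $\Gamma$ and $\vartheta$, such that for all $t>C$ and all $\gamma\in\Gamma^{lox}_c$ with $\|\lambda(\gamma)\|\le t$, $$\mathrm{Leb}\big(F_{[\gamma]}\cap\Omega(e^{\vartheta t})^c\big)\le C'\,\mathrm{Leb}\big(F_{[\gamma]}\cap\Omega(e^{\vartheta t/8},e^{\vartheta t})\big).$$ -/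

import Mathlib

open Matrix MeasureTheory

noncomputable section

namespace FlatTori

/-- `G = SL(d, ℝ)`. -/
abbrev G (d : ℕ) : Type := Matrix.SpecialLinearGroup (Fin d) ℝ

/-- The underlying matrix of an element of `SL(d, R)`. -/
abbrev mat {d : ℕ} {R : Type} [CommRing R] (g : Matrix.SpecialLinearGroup (Fin d) R) :
    Matrix (Fin d) (Fin d) R := (g : Matrix (Fin d) (Fin d) R)

theorem mat_mul {d : ℕ} {R : Type} [CommRing R] (g h : Matrix.SpecialLinearGroup (Fin d) R) :
    mat (g * h) = mat g * mat h := Matrix.SpecialLinearGroup.coe_mul g h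

theorem mat_mul_inv {d : ℕ} {R : Type} [CommRing R] (g : Matrix.SpecialLinearGroup (Fin d) R) :
    mat g * mat g⁻¹ = 1 := by
  rw [← mat_mul, mul_inv_cancel]
  exact Matrix.SpecialLinearGroup.coe_one

/-- The Cartan subspace `𝔞`: (diagonal matrices given by) real vectors of size `d` with zero sum. -/
def cartan (d : ℕ) : Submodule ℝ (EuclideanSpace ℝ (Fin d)) where
  carrier := {Y | ∑ i, Y i = 0}
  zero_mem' := by simp
  add_mem' := by
    intro a b ha hb
    simp only [Set.mem_ofPred_eq, PiLp.add_apply, Finset.sum_add_distrib] at *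
    rw [ha, hb, add_zero]
  smul_mem' := by
    intro c a ha
    simp only [Set.mem_ofPred_eq, PiLp.smul_apply, smul_eq_mul, ← Finset.mul_sum] at *
    rw [ha, mul_zero]

/-- The norm on `𝔞` given by the Killing form `B(Y, Y) = tr (ad Y ∘ ad Y)` of `𝔰𝔩(d, ℝ)`: the
endomorphism `ad Y` is diagonalizable, with the eigenvalues `Y i - Y j` for `i ≠ j` and `0`. -/
def killingNorm {d : ℕ} (Y : cartan d) : ℝ :=
  Real.sqrt (∑ i, ∑ j, (Y.1 i - Y.1 j) ^ 2)

/-- Lebesgue measure on the Euclidean space `𝔞`. -/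
def leb (d : ℕ) : Measure (cartan d) :=
  (stdOrthonormalBasis ℝ (cartan d)).toBasis.addHaar

/-- The open positive Weyl chamber `𝔞⁺⁺`: `Y 0 > Y 1 > ⋯ > Y (d - 1)`. -/
def openChamber (d : ℕ) : Set (cartan d) := {Y | StrictAnti fun i => Y.1 i}

/-- The closed positive Weyl chamber `𝔞⁺`: `Y 0 ≥ Y 1 ≥ ⋯ ≥ Y (d - 1)`. -/
def closedChamber (d : ℕ) : Set (cartan d) := {Y | Antitone fun i => Y.1 i}

/-- The exponential map `𝔞 → SL(d, ℝ)`; its range is `A`. -/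
def expA {d : ℕ} (Y : cartan d) : G d :=
  ⟨Matrix.diagonal fun i => Real.exp (Y.1 i), by
    have h : ∑ i, Y.1 i = 0 := Y.2
    rw [Matrix.det_diagonal, ← Real.exp_sum, h, Real.exp_zero]⟩

theorem expA_zero {d : ℕ} : expA (0 : cartan d) = 1 := by
  apply Subtype.ext
  simp [expA]

theorem expA_add {d : ℕ} (Y Z : cartan d) : expA (Y + Z) = expA Y * expA Z := by
  apply Subtype.ext
  change Matrix.diagonal _ = Matrix.diagonal _ * Matrix.diagonal _
  simp [Matrix.diagonal_mul_diagonal, Real.exp_add]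

/-- The maximal compact subgroup `K = SO(d)`. -/
def K (d : ℕ) : Subgroup (G d) where
  carrier := {k | mat k * (mat k)ᵀ = 1}
  one_mem' := by simp
  mul_mem' := by
    intro a b ha hb
    simp only [Set.mem_ofPred_eq, mat_mul, Matrix.transpose_mul] at *
    calc mat a * mat b * ((mat b)ᵀ * (mat a)ᵀ) = mat a * (mat b * (mat b)ᵀ) * (mat a)ᵀ := by
          simp only [Matrix.mul_assoc]
      _ = 1 := by rw [hb, Matrix.mul_one, ha]
  inv_mem' := by
    intro a ha
    simp only [Set.mem_ofPred_eq] at *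
    have h1 : mat a * mat a⁻¹ = 1 := mat_mul_inv a
    have h2 : mat a⁻¹ = (mat a)ᵀ := by
      have h3 : (mat a)ᵀ * mat a = 1 := mul_eq_one_comm.mp ha
      calc mat a⁻¹ = ((mat a)ᵀ * mat a) * mat a⁻¹ := by rw [h3, Matrix.one_mul]
        _ = (mat a)ᵀ := by rw [Matrix.mul_assoc, h1, Matrix.mul_one]
    rw [h2, Matrix.transpose_transpose]
    exact mul_eq_one_comm.mp ha

/-- `M = Z_K(A)`, the centralizer of `A` in `K`. -/
def M (d : ℕ) : Subgroup (G d) := K d ⊓ Subgroup.centralizer (Set.range expA)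

/-- `g` belongs to `N`, the group of unipotent upper triangular matrices. -/
def InN {d : ℕ} (g : G d) : Prop := (∀ i j, j < i → mat g i j = 0) ∧ ∀ i, mat g i i = 1

/-- `Y ∈ 𝔞⁺` is the Jordan projection of `g`: there is a decomposition `g = e h u` into commuting
factors, with `e`, `h`, `u` conjugate to an element of `K`, to `exp Y`, to an element of `N`. -/
def IsJordanProjection {d : ℕ} (g : G d) (Y : cartan d) : Prop :=
  Y ∈ closedChamber d ∧ ∃ e h u : G d, g = e * h * u ∧
    Commute e h ∧ Commute e u ∧ Commute h u ∧
    (∃ k ∈ K d, IsConj e k) ∧ IsConj h (expA Y) ∧ ∃ n : G d, InN n ∧ IsConj u n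

open Classical in
/-- The Jordan projection `λ : G → 𝔞⁺`. -/
def jordan {d : ℕ} (g : G d) : cartan d :=
  if h : ∃ Y, IsJordanProjection g Y then h.choose else 0

/-- `g` is loxodromic if its Jordan projection is in the open chamber. -/
def IsLoxodromic {d : ℕ} (g : G d) : Prop := jordan g ∈ openChamber d

/-- The inclusion of `SL(d, ℤ)` in `SL(d, ℝ)`. -/
def incl (d : ℕ) : Matrix.SpecialLinearGroup (Fin d) ℤ →* G d :=
  Matrix.SpecialLinearGroup.map (Int.castRingHom ℝ)

/-- The double coset space `Γ \ G / M`. -/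
abbrev FlatSpace {d : ℕ} (Γ : Subgroup (Matrix.SpecialLinearGroup (Fin d) ℤ)) : Type :=
  DoubleCoset.Quotient (Γ.map (incl d) : Set (G d)) (M d : Set (G d))

section
variable {d : ℕ} (Γ : Subgroup (Matrix.SpecialLinearGroup (Fin d) ℤ))

/-- The point `Γ g M` of `Γ \ G / M`. -/
def pt (g : G d) : FlatSpace Γ := DoubleCoset.mk (Γ.map (incl d)) (M d) g

theorem pt_eq_iff (g h : G d) :
    pt Γ g = pt Γ h ↔ ∃ γ ∈ Γ, ∃ m ∈ M d, h = incl d γ * g * m := by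
  unfold pt
  rw [DoubleCoset.eq]
  constructor
  · rintro ⟨_, ⟨γ, hγ, rfl⟩, m, hm, h⟩
    exact ⟨γ, hγ, m, hm, h⟩
  · rintro ⟨γ, hγ, m, hm, h⟩
    exact ⟨_, ⟨γ, hγ, rfl⟩, m, hm, h⟩

/-- The right action of `A` on `Γ \ G / M`: `Γ g M` is sent to `Γ g exp(Y) M`. -/
def flow (Y : cartan d) : FlatSpace Γ → FlatSpace Γ :=
  Quotient.lift (fun g => pt Γ (g * expA Y)) (by
    intro g h hgh
    obtain ⟨γ, hγ, m, hm, rfl⟩ := (pt_eq_iff Γ g h).1 (Quotient.sound hgh)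
    refine (pt_eq_iff Γ _ _).2 ⟨γ, hγ, m, hm, ?_⟩
    have hc : expA Y * m = m * expA Y :=
      (Subgroup.mem_centralizer_iff.1 (Subgroup.mem_inf.1 hm).2) _ ⟨Y, rfl⟩
    simp only [mul_assoc, hc])

theorem flow_pt (Y : cartan d) (g : G d) : flow Γ Y (pt Γ g) = pt Γ (g * expA Y) := rfl

theorem flow_zero (z : FlatSpace Γ) : flow Γ 0 z = z := by
  induction z using Quotient.inductionOn with
  | h g =>
    change pt Γ (g * expA 0) = pt Γ g
    rw [expA_zero, mul_one]

theorem flow_add (Y Z : cartan d) (z : FlatSpace Γ) :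
    flow Γ (Y + Z) z = flow Γ Z (flow Γ Y z) := by
  induction z using Quotient.inductionOn with
  | h g =>
    change pt Γ (g * expA (Y + Z)) = pt Γ (g * expA Y * expA Z)
    rw [expA_add, mul_assoc]

/-- The group `Λ(F)` of periods of a subset `F` of `Γ \ G / M`. -/
def periods (F : Set (FlatSpace Γ)) : Submodule ℤ (cartan d) :=
  AddSubgroup.toIntSubmodule
    { carrier := {Y | ∀ z ∈ F, flow Γ Y z = z}
      zero_mem' := fun z _ => flow_zero Γ z
      add_mem' := by
        intro Y Z hY hZ z hz
        rw [flow_add, hY z hz, hZ z hz]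
      neg_mem' := by
        intro Y hY z hz
        have h := flow_add Γ Y (-Y) z
        rw [add_neg_cancel, flow_zero, hY z hz] at h
        exact h.symm }

/-- `F` is a compact periodic `A`-orbit (a maximal flat periodic torus): an `A`-orbit whose group
of periods is a lattice of `𝔞`. -/
def IsCompactPeriodic (F : Set (FlatSpace Γ)) : Prop :=
  (∃ z, F = Set.range fun Y => flow Γ Y z) ∧
    ∃ _ : DiscreteTopology (periods Γ F), IsZLattice ℝ (periods Γ F)

/-- The `A`-orbit `F_[γ] = Γ g A M` of a loxodromic element `γ`, where `g` is any element such that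
`g⁻¹ γ g ∈ exp(λ(γ)) M`. All such `g` form a single class of `G / AM`. -/
def orbit (γ : Matrix.SpecialLinearGroup (Fin d) ℤ) : Set (FlatSpace Γ) :=
  {z | ∃ g : G d, z = pt Γ g ∧
    ∃ m ∈ M d, g⁻¹ * incl d γ * g = expA (jordan (incl d γ)) * m}

/-- The set `Γ_c^lox` of loxodromic elements of `Γ` whose `A`-orbit is compact periodic. -/
def loxCompact : Set (Matrix.SpecialLinearGroup (Fin d) ℤ) :=
  {γ | γ ∈ Γ ∧ IsLoxodromic (incl d γ) ∧ IsCompactPeriodic Γ (orbit Γ γ)}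

open Classical in
/-- The measure of `F ∩ E` for the quotient measure on the `A`-orbit `F ≃ 𝔞 / Λ(F)` of Lebesgue
measure: the Lebesgue measure of the set of all `Y` in a fundamental domain `D` of `Λ(F)` such that
`z exp(Y) ∈ E`, where `z` is a base point on `F`. It does not depend on `z` and `D`. -/
def orbitLeb (F E : Set (FlatSpace Γ)) : ENNReal :=
  if h : ∃ p : FlatSpace Γ × Set (cartan d),
      p.1 ∈ F ∧ IsAddFundamentalDomain (periods Γ F) p.2 (leb d) then
    leb d {Y | Y ∈ h.choose.2 ∧ flow Γ Y h.choose.1 ∈ E}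
  else 0

end

/-- The systole `s(g)`: the smallest Euclidean norm of a nonzero vector of the lattice `ℤ^d g`
of row vectors. -/
def systoleG {d : ℕ} (g : G d) : ℝ :=
  sInf {r | ∃ v : Fin d → ℤ, v ≠ 0 ∧ r = ‖WithLp.toLp 2 ((fun i => (v i : ℝ)) ᵥ* mat g)‖}

theorem norm_vecMul_of_mem_K {d : ℕ} {k : G d} (hk : k ∈ K d) (w : Fin d → ℝ) :
    ‖WithLp.toLp 2 (w ᵥ* mat k)‖ = ‖WithLp.toLp 2 w‖ := by
  have hk' : mat k * (mat k)ᵀ = 1 := hk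
  have key : ∀ u : Fin d → ℝ, ‖WithLp.toLp 2 u‖ ^ 2 = u ⬝ᵥ u := by
    intro u
    rw [EuclideanSpace.norm_sq_eq]
    simp [dotProduct, sq]
  have h2 : ‖WithLp.toLp 2 (w ᵥ* mat k)‖ ^ 2 = ‖WithLp.toLp 2 w‖ ^ 2 := by
    rw [key, key, ← Matrix.mulVec_transpose (mat k) w, Matrix.dotProduct_mulVec,
      Matrix.vecMul_transpose, Matrix.mulVec_mulVec, hk', Matrix.one_mulVec]
  exact (sq_eq_sq₀ (norm_nonneg _) (norm_nonneg _)).1 h2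

theorem normSet_mul_eq {d : ℕ} (γ : Matrix.SpecialLinearGroup (Fin d) ℤ) (g : G d) {m : G d}
    (hm : m ∈ K d) :
    {r | ∃ v : Fin d → ℤ, v ≠ 0 ∧
      r = ‖WithLp.toLp 2 ((fun i => (v i : ℝ)) ᵥ* mat (incl d γ * g * m))‖} =
    {r | ∃ v : Fin d → ℤ, v ≠ 0 ∧ r = ‖WithLp.toLp 2 ((fun i => (v i : ℝ)) ᵥ* mat g)‖} := by
  have hγ : ∀ v : Fin d → ℤ, (fun i => (v i : ℝ)) ᵥ* mat (incl d γ) =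
      fun i => (((v ᵥ* mat γ) i : ℤ) : ℝ) := by
    intro v
    ext i
    simp [incl, Matrix.vecMul, dotProduct]
  have hn : ∀ v : Fin d → ℤ,
      ‖WithLp.toLp 2 ((fun i => (v i : ℝ)) ᵥ* mat (incl d γ * g * m))‖ =
      ‖WithLp.toLp 2 ((fun i => (((v ᵥ* mat γ) i : ℤ) : ℝ)) ᵥ* mat g)‖ := by
    intro v
    rw [mat_mul, ← Matrix.vecMul_vecMul, norm_vecMul_of_mem_K hm,
      mat_mul, ← Matrix.vecMul_vecMul, hγ]
  have hl : mat γ * mat γ⁻¹ = 1 := mat_mul_inv γ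
  have hr : mat γ⁻¹ * mat γ = 1 := mul_eq_one_comm.mp hl
  ext r
  constructor
  · rintro ⟨v, hv, rfl⟩
    refine ⟨v ᵥ* mat γ, ?_, hn v⟩
    intro h0
    apply hv
    have : v = (v ᵥ* mat γ) ᵥ* mat γ⁻¹ := by rw [Matrix.vecMul_vecMul, hl, Matrix.vecMul_one]
    rw [this, h0, Matrix.zero_vecMul]
  · rintro ⟨v, hv, rfl⟩
    have hv' : (v ᵥ* mat γ⁻¹) ᵥ* mat γ = v := by rw [Matrix.vecMul_vecMul, hr, Matrix.vecMul_one]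
    refine ⟨v ᵥ* mat γ⁻¹, ?_, ?_⟩
    · intro h0
      apply hv
      rw [← hv', h0, Matrix.zero_vecMul]
    · rw [hn, hv']

section
variable {d : ℕ} (Γ : Subgroup (Matrix.SpecialLinearGroup (Fin d) ℤ))

/-- The systole as a function on `Γ \ G / M`. -/
def systole : FlatSpace Γ → ℝ :=
  Quotient.lift systoleG (by
    intro g h hgh
    obtain ⟨γ, _, m, hm, rfl⟩ := (pt_eq_iff Γ g h).1 (Quotient.sound hgh)
    exact congrArg sInf (normSet_mul_eq γ g (Subgroup.mem_inf.1 hm).1).symm)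

/-- `Ω(R) = {z | 1 / s(z) ≤ R}`. -/
def Omega (R : ℝ) : Set (FlatSpace Γ) := {z | 1 / systole Γ z ≤ R}

/-- `Ω(R₁, R₂) = {z | R₁ < 1 / s(z) ≤ R₂}`. -/
def OmegaShell (R₁ R₂ : ℝ) : Set (FlatSpace Γ) :=
  {z | R₁ < 1 / systole Γ z ∧ 1 / systole Γ z ≤ R₂}

end

end FlatTori

end

set_option linter.unusedSectionVars false

/-! Fix a base point `pt Γ g` of the orbit and follow the lattices ℤᵈ g exp(Y) for Y in 𝔞. The
logarithm of their systole is 1-Lipschitz in Y. Hence it suffices to find, within distance O(t) of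
each Y where it is below -ϑt, a point Y' where it equals -ϑt/2: the ball of radius ϑt/4 about Y'
then lies over the shell. Since this radius is comparable to the distance from Y, averaging over
translations modulo the periods gives the inequality of measures
(`measure_inter_fundamentalDomain_le`).

The point Y' comes from a path of length O(t) that leads from Y to a lattice whose systole is
bounded below.

The start of the path is not too degenerate (`weightedCovolGE_of_conj`). The element γ acts on the
lattice at Y as a diagonal matrix with distinct entries of size at most exp t. Compactness of the
orbit prevents a nonzero lattice vector from having a zero coordinate, so the images of a short
vector under the first d powers of γ are independent, by Vandermonde, and have size exp(O(t)).
Completing a basis of a sublattice by some of them gives an integer determinant, so every sublattice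
has covolume at least exp(-O(t)).

A bounded translation then multiplies the smallest covolume by a fixed factor
(`exists_weightedCovolGE_step`). With covolumes weighted by a strictly concave function of the rank,
submodularity forces the nearly minimal sublattices to span a chain of subspaces, as in the
Harder-Narasimhan filtration. A chain has nested sets of pivot coordinates, and one direction of 𝔞
has positive sum over each proper nonempty set of a nested family; moving along it enlarges all
nearly minimal covolumes together. After O(t) such steps all weighted covolumes are at least 1, and
rank one bounds the systole. -/

namespace FlatTori

/-! ### Maximal minors as a substitute for covolumes -/

section Minors

variable {ι κ l n : Type*} [Fintype ι] [DecidableEq ι] [Fintype κ] [DecidableEq κ]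
  [Fintype l] [DecidableEq l] [Fintype n] [DecidableEq n]

/-- The largest absolute value of a maximal minor of a matrix with rows indexed by `ι`. -/
noncomputable def maxMinor (W : Matrix ι n ℝ) : ℝ := ⨆ I : ι → n, |(W.submatrix id I).det|

theorem abs_det_submatrix_le_maxMinor (W : Matrix ι n ℝ) (I : ι → n) :
    |(W.submatrix id I).det| ≤ maxMinor W :=
  le_ciSup (f := fun I : ι → n => |(W.submatrix id I).det|) (Set.finite_range _).bddAbove I

theorem maxMinor_nonneg (W : Matrix ι n ℝ) : 0 ≤ maxMinor W :=
  Real.iSup_nonneg fun _ => abs_nonneg _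

theorem exists_abs_det_eq_maxMinor [Nonempty n] (W : Matrix ι n ℝ) :
    ∃ I : ι → n, |(W.submatrix id I).det| = maxMinor W :=
  exists_eq_ciSup_of_finite

theorem maxMinor_le [Nonempty n] {W : Matrix ι n ℝ} {c : ℝ}
    (h : ∀ I : ι → n, |(W.submatrix id I).det| ≤ c) : maxMinor W ≤ c := by
  obtain ⟨I, hI⟩ := exists_abs_det_eq_maxMinor W
  exact hI ▸ h I

theorem maxMinor_mul (U : Matrix ι ι ℝ) (W : Matrix ι n ℝ) :
    maxMinor (U * W) = |U.det| * maxMinor W := by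
  unfold maxMinor
  rw [Real.mul_iSup_of_nonneg (abs_nonneg _)]
  congr 1
  ext I
  rw [← abs_mul, ← Matrix.det_mul]
  rfl

theorem maxMinor_of_isEmpty [IsEmpty ι] (W : Matrix ι n ℝ) : maxMinor W = 1 := by
  unfold maxMinor
  simp

theorem maxMinor_reindex (e : ι ≃ κ) (W : Matrix κ n ℝ) :
    maxMinor (W.submatrix e id) = maxMinor W := by
  unfold maxMinor
  rw [← (Equiv.arrowCongr e (Equiv.refl n)).iSup_comp]
  congr 1
  ext I
  rw [← Matrix.det_submatrix_equiv_self e]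
  congr 2
  ext i j
  simp

theorem maxMinor_square (W : Matrix n n ℝ) : maxMinor W = |W.det| := by
  apply le_antisymm
  · rcases isEmpty_or_nonempty n with h | h
    · rw [maxMinor_of_isEmpty]; simp
    apply maxMinor_le
    intro I
    by_cases hI : Function.Injective I
    · have hb := Finite.injective_iff_bijective.1 hI
      have := Matrix.det_permute' (Equiv.ofBijective I hb) W
      have h2 : (W.submatrix id I).det = _ := this
      rw [h2, abs_mul]
      rcases Int.units_eq_one_or (Equiv.Perm.sign (Equiv.ofBijective I hb)) with h | h <;> simp [h]
    · rw [Function.not_injective_iff] at hI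
      obtain ⟨a, b, hab, hne⟩ := hI
      rw [Matrix.det_zero_of_column_eq hne, abs_zero]
      · exact abs_nonneg _
      · intro i; simp [hab]
  · simpa using abs_det_submatrix_le_maxMinor W id

theorem exists_det_submatrix_ne_zero {k : Type*} [Field k] {W : Matrix ι n k}
    (hW : LinearIndependent k W.row) : ∃ I : ι → n, (W.submatrix id I).det ≠ 0 := by
  have h1 : W.rank = Fintype.card ι := hW.rank_matrix
  rw [Matrix.rank_eq_finrank_span_cols] at h1
  have h2 : Submodule.span k (Set.range W.col) = ⊤ :=
    Submodule.eq_top_of_finrank_eq (by rw [h1, Module.finrank_pi])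
  obtain ⟨b, hb, hspan, hli⟩ := exists_linearIndependent k (Set.range W.col)
  rw [h2] at hspan
  let B : Module.Basis b k (ι → k) := Module.Basis.mk hli (by simp [hspan])
  let e : ι ≃ b := (Pi.basisFun k ι).indexEquiv B
  have hI : ∀ i, ∃ j, W.col j = e i := fun i => hb (e i).2
  choose I hI using hI
  refine ⟨I, ?_⟩
  rw [← isUnit_iff_ne_zero, ← Matrix.isUnit_iff_isUnit_det,
    ← Matrix.linearIndependent_cols_iff_isUnit]
  have : (W.submatrix id I).col = Subtype.val ∘ e := by
    ext i j
    simp only [Function.comp, ← hI i]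
    rfl
  rw [this]
  exact hli.comp _ e.injective

theorem linearIndependent_row_of_det_submatrix_ne_zero {k : Type*} [Field k] {W : Matrix ι n k}
    {I : ι → n} (h : (W.submatrix id I).det ≠ 0) : LinearIndependent k W.row :=
  LinearIndependent.of_comp (LinearMap.funLeft k k I)
    (Matrix.linearIndependent_rows_of_det_ne_zero h)

theorem maxMinor_pos {W : Matrix ι n ℝ} (hW : LinearIndependent ℝ W.row) : 0 < maxMinor W := by
  obtain ⟨I, hI⟩ := exists_det_submatrix_ne_zero hW
  exact lt_of_lt_of_le (abs_pos.2 hI) (abs_det_submatrix_le_maxMinor W I)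

/-- Integer vectors which are independent over `ℤ` are independent over `ℝ`. -/
theorem linearIndependent_row_intCast {V : Matrix ι n ℤ} (hV : LinearIndependent ℤ V.row) :
    LinearIndependent ℝ (V.map (Int.cast : ℤ → ℝ)).row := by
  let f : (n → ℤ) →ₗ[ℤ] (n → ℚ) := (Int.castAddHom ℚ).toIntLinearMap.compLeft n
  have hf : Function.Injective f := fun x y hxy => by
    ext i
    have := congrFun hxy i
    exact Int.cast_injective (α := ℚ) this
  have h1 : LinearIndependent ℤ (V.map (Int.cast : ℤ → ℚ)).row :=
    hV.map' f (LinearMap.ker_eq_bot.2 hf)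
  -- Over the field ℚ independence is witnessed by a nonzero minor, which stays nonzero in ℝ.
  rw [LinearIndependent.iff_fractionRing ℤ ℚ] at h1
  obtain ⟨I, hI⟩ := exists_det_submatrix_ne_zero h1
  apply linearIndependent_row_of_det_submatrix_ne_zero (I := I)
  have h2 : ((V.map (Int.cast : ℤ → ℝ)).submatrix id I).det =
      (((V.map (Int.cast : ℤ → ℚ)).submatrix id I).det : ℝ) := by
    rw [← Rat.coe_castHom, RingHom.map_det]
    congr 1
  rw [h2]
  exact_mod_cast hI

/-- A matrix factors through its largest minor, the other factor having entries at most `1`. -/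
theorem exists_eq_submatrix_mul [Nonempty n] {W : Matrix ι n ℝ} (hW : maxMinor W ≠ 0) :
    ∃ (I : ι → n) (R : Matrix ι n ℝ), |(W.submatrix id I).det| = maxMinor W ∧
      W = W.submatrix id I * R ∧ ∀ i j, |R i j| ≤ 1 := by
  obtain ⟨I, hI⟩ := exists_abs_det_eq_maxMinor W
  have hdet : (W.submatrix id I).det ≠ 0 := by
    rw [← abs_ne_zero, hI]; exact hW
  have hu : IsUnit (W.submatrix id I).det := isUnit_iff_ne_zero.2 hdet
  refine ⟨I, (W.submatrix id I)⁻¹ * W, hI, ?_, ?_⟩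
  · rw [← Matrix.mul_assoc, Matrix.mul_nonsing_inv _ hu, Matrix.one_mul]
  · intro i j
    -- By Cramer's rule the entries of the second factor are quotients of minors of `W` by the
    -- largest one.
    have h1 := Matrix.det_smul_inv_mulVec_eq_cramer (W.submatrix id I) (W.col j) hu
    have h2 := congrFun h1 i
    rw [Matrix.cramer_apply] at h2
    have h3 : (W.submatrix id I).updateCol i (W.col j) =
        W.submatrix id (Function.update I i j) := by
      ext a b
      by_cases hb : b = i
      · subst hb; simp
      · simp [hb, Function.update_of_ne]
    rw [h3] at h2
    have h4 : ((W.submatrix id I)⁻¹ *ᵥ W.col j) i = ((W.submatrix id I)⁻¹ * W) i j := rfl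
    simp only [Pi.smul_apply, smul_eq_mul, h4] at h2
    have h5 := abs_det_submatrix_le_maxMinor W (Function.update I i j)
    rw [← h2, abs_mul, hI] at h5
    have h6 : 0 < maxMinor W := lt_of_le_of_ne (maxMinor_nonneg W) hW.symm
    exact le_of_mul_le_mul_left (by simpa using h5) h6

theorem abs_det_le {A : Matrix ι ι ℝ} {x : ℝ} (h : ∀ i j, |A i j| ≤ x) :
    |A.det| ≤ (Fintype.card ι).factorial * x ^ Fintype.card ι := by
  have := Matrix.det_le (abv := AbsoluteValue.abs) (A := A) (x := x) h
  simpa using this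

/-- Minors of a matrix, some rows of which have bounded entries. -/
theorem abs_det_le_maxMinor_mul [Nonempty n] {W : Matrix ι n ℝ} {U : Matrix κ n ℝ} {c : ℝ}
    (hc : 1 ≤ c) (hU : ∀ i j, |U i j| ≤ c) (hW : LinearIndependent ℝ W.row)
    (K : ι ⊕ κ → n) :
    |((fromRows W U).submatrix id K).det| ≤
      maxMinor W * ((Fintype.card (ι ⊕ κ)).factorial * c ^ Fintype.card (ι ⊕ κ)) := by
  obtain ⟨I, R, hI, hR, hb⟩ := exists_eq_submatrix_mul (maxMinor_pos hW).ne'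
  have h1 : fromRows W U =
      fromBlocks (W.submatrix id I) 0 0 (1 : Matrix κ κ ℝ) * fromRows R U := by
    rw [fromBlocks_mul_fromRows, ← hR]; simp
  have h2 : (fromRows W U).submatrix id K =
      fromBlocks (W.submatrix id I) 0 0 (1 : Matrix κ κ ℝ) * (fromRows R U).submatrix id K := by
    conv_lhs => rw [h1]
    rfl
  rw [h2, Matrix.det_mul, Matrix.det_fromBlocks_zero₂₁, Matrix.det_one, mul_one, abs_mul, hI]
  refine mul_le_mul_of_nonneg_left (abs_det_le ?_) (maxMinor_nonneg _)
  rintro (i | i) j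
  · exact (hb _ _).trans hc
  · exact hU _ _

theorem maxMinor_fromRows_le [Nonempty n] {W : Matrix ι n ℝ} {U : Matrix κ n ℝ} {c : ℝ}
    (hc : 1 ≤ c) (hU : ∀ i j, |U i j| ≤ c) (hW : LinearIndependent ℝ W.row) :
    maxMinor (fromRows W U) ≤
      maxMinor W * ((Fintype.card (ι ⊕ κ)).factorial * c ^ Fintype.card (ι ⊕ κ)) :=
  maxMinor_le (abs_det_le_maxMinor_mul hc hU hW)

theorem linearIndependent_row_mul {U : Matrix ι ι ℝ} (hU : U.det ≠ 0) {W : Matrix ι n ℝ}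
    (hW : LinearIndependent ℝ W.row) : LinearIndependent ℝ (U * W).row := by
  have hu : IsUnit U.det := isUnit_iff_ne_zero.2 hU
  rw [← Matrix.vecMul_injective_iff] at hW ⊢
  intro x y hxy
  simp only [← Matrix.vecMul_vecMul] at hxy
  have h := hW hxy
  exact (Matrix.vecMul_injective_iff_isUnit.2 ((Matrix.isUnit_iff_isUnit_det U).2 hu)) h

/-- Submodularity of the covolume, up to a constant. -/
theorem maxMinor_submodular [Nonempty n] {A : Matrix ι n ℝ} {B : Matrix κ n ℝ} {C : Matrix l n ℝ}
    (h : LinearIndependent ℝ (fromRows (fromRows A B) C).row) :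
    maxMinor A * maxMinor (fromRows (fromRows A B) C) ≤
      (Fintype.card ((ι ⊕ κ) ⊕ l)).factorial *
        (maxMinor (fromRows A B) * maxMinor (fromRows A C)) := by
  have hAB : LinearIndependent ℝ (fromRows A B).row :=
    (h.comp Sum.inl Sum.inl_injective : _)
  have hA : LinearIndependent ℝ A.row := (hAB.comp Sum.inl Sum.inl_injective : _)
  obtain ⟨I, R, hI, hR, -⟩ := exists_eq_submatrix_mul (maxMinor_pos hA).ne'
  have hdet : (A.submatrix id I).det ≠ 0 := by
    rw [← abs_ne_zero, hI]; exact (maxMinor_pos hA).ne'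
  set P := A.submatrix id I with hP
  have hu : IsUnit P.det := isUnit_iff_ne_zero.2 hdet
  -- Subtracting combinations of the rows of `A` clears the columns `I` of `C`. This is a unipotent
  -- row operation, so no maximal minor of the stacked matrices changes in absolute value.
  set Q : Matrix l ι ℝ := -(C.submatrix id I * P⁻¹) with hQ
  set C' : Matrix l n ℝ := Q * A + C with hC'
  have hzero : C'.submatrix id I = 0 := by
    have : C'.submatrix id I = Q * P + C.submatrix id I := rfl
    rw [this, hQ, Matrix.neg_mul, Matrix.mul_assoc, Matrix.nonsing_inv_mul _ hu, Matrix.mul_one,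
      neg_add_cancel]
  have e1 : fromRows A C' = fromBlocks (1 : Matrix ι ι ℝ) 0 Q (1 : Matrix l l ℝ) * fromRows A C := by
    rw [fromBlocks_mul_fromRows]; simp [hC']
  have h1 : maxMinor (fromRows A C') = maxMinor (fromRows A C) := by
    rw [e1, maxMinor_mul, Matrix.det_fromBlocks_zero₁₂]; simp
  have e2 : fromRows (fromRows A B) C' =
      fromBlocks (1 : Matrix (ι ⊕ κ) (ι ⊕ κ) ℝ) 0 (fromCols Q 0) (1 : Matrix l l ℝ) *
        fromRows (fromRows A B) C := by
    rw [fromBlocks_mul_fromRows, fromCols_mul_fromRows]; simp [hC']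
  have h2 : maxMinor (fromRows (fromRows A B) C') = maxMinor (fromRows (fromRows A B) C) := by
    rw [e2, maxMinor_mul, Matrix.det_fromBlocks_zero₁₂]; simp
  have h3 : LinearIndependent ℝ (fromRows (fromRows A B) C').row := by
    rw [e2]
    apply linearIndependent_row_mul _ h
    rw [Matrix.det_fromBlocks_zero₁₂]; simp
  have hC'i : LinearIndependent ℝ C'.row := (h3.comp Sum.inr Sum.inr_injective : _)
  -- The minor on the columns `I` and `L` is block triangular, hence a product.
  have h4 : maxMinor A * maxMinor C' ≤ maxMinor (fromRows A C) := by
    obtain ⟨L, hL⟩ := exists_abs_det_eq_maxMinor C'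
    rw [← h1, ← hL, ← hI, ← abs_mul]
    refine le_trans (le_of_eq ?_) (abs_det_submatrix_le_maxMinor (fromRows A C') (Sum.elim I L))
    have : (fromRows A C').submatrix id (Sum.elim I L) =
        fromBlocks P (A.submatrix id L) 0 (C'.submatrix id L) := by
      rw [← hzero]
      ext (i | i) (j | j) <;> rfl
    rw [this, Matrix.det_fromBlocks_zero₂₁]
  -- In the other direction, `C'` contributes at most its largest minor, since the remaining factor
  -- has entries bounded by 1.
  obtain ⟨S, R', hS, hR', hb'⟩ := exists_eq_submatrix_mul (maxMinor_pos hC'i).ne'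
  have h5 : maxMinor (fromRows (fromRows A B) C') =
      maxMinor C' * maxMinor (fromRows (fromRows A B) R') := by
    have : fromRows (fromRows A B) C' =
      fromBlocks (1 : Matrix (ι ⊕ κ) (ι ⊕ κ) ℝ) 0 0 (C'.submatrix id S) *
        fromRows (fromRows A B) R' := by
      rw [fromBlocks_mul_fromRows, ← hR']; simp
    rw [this, maxMinor_mul, Matrix.det_fromBlocks_zero₁₂, Matrix.det_one, one_mul, hS]
  have h6 := maxMinor_fromRows_le le_rfl hb' hAB
  rw [one_pow, mul_one] at h6
  rw [← h2, h5, ← mul_assoc]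
  calc _ ≤ maxMinor (fromRows A C) *
        (maxMinor (fromRows A B) * (Fintype.card ((ι ⊕ κ) ⊕ l)).factorial) :=
        mul_le_mul h4 h6 (maxMinor_nonneg _) (maxMinor_nonneg _)
    _ = _ := by ring

end Minors

end FlatTori

namespace FlatTori

/-! ### Pivot coordinates of chains of subspaces, and a direction expanding all of them -/

section Pivots

variable {ι n : Type*} [Fintype ι] [DecidableEq ι] [Fintype n] [DecidableEq n]

/-- The coordinates in `J` determine the vectors of `E`, with the constant `C` for sup norms. -/
def IsPivot (C : ℝ) (E : Submodule ℝ (n → ℝ)) (J : Finset n) : Prop :=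
  J.card = Module.finrank ℝ E ∧
    ∀ x ∈ E, ∀ B : ℝ, 0 ≤ B → (∀ k ∈ J, |x k| ≤ B) → ∀ i, |x i| ≤ C * B

theorem IsPivot.mono {C C' : ℝ} {E : Submodule ℝ (n → ℝ)} {J : Finset n} (h : IsPivot C E J)
    (hC : C ≤ C') : IsPivot C' E J :=
  ⟨h.1, fun x hx B hB hk i => (h.2 x hx B hB hk i).trans (mul_le_mul_of_nonneg_right hC hB)⟩

theorem IsPivot.eq_zero {C : ℝ} {E : Submodule ℝ (n → ℝ)} {J : Finset n} (h : IsPivot C E J)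
    {x : n → ℝ} (hx : x ∈ E) (hk : ∀ k ∈ J, x k = 0) : x = 0 := by
  ext i
  have := h.2 x hx 0 le_rfl (fun k hkJ => by rw [hk k hkJ, abs_zero]) i
  rw [mul_zero] at this
  simpa using this

/-- The columns of a largest minor of a basis serve: the other coordinates are combinations of these
with coefficients at most 1. -/
theorem exists_isPivot [Nonempty n] (E : Submodule ℝ (n → ℝ)) :
    ∃ J, IsPivot (Fintype.card n) E J := by
  let b := Module.finBasis ℝ E
  let W : Matrix (Fin (Module.finrank ℝ E)) n ℝ := Matrix.of fun i => (b i : n → ℝ)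
  have hW : LinearIndependent ℝ W.row :=
    b.linearIndependent.map' E.subtype (Submodule.ker_subtype E)
  obtain ⟨I, R, hI, hR, hb⟩ := exists_eq_submatrix_mul (maxMinor_pos hW).ne'
  have hinj : Function.Injective I := by
    by_contra hn
    rw [Function.not_injective_iff] at hn
    obtain ⟨p, q, hpq, hne⟩ := hn
    rw [Matrix.det_zero_of_column_eq hne (fun i => by simp [hpq]), abs_zero] at hI
    exact (maxMinor_pos hW).ne hI
  refine ⟨Finset.univ.image I, ?_, ?_⟩
  · rw [Finset.card_image_of_injective _ hinj, Finset.card_univ, Fintype.card_fin]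
  · intro x hx B hB hk i
    have h1 : x = (b.repr ⟨x, hx⟩) ᵥ* W := by
      have := congrArg (Submodule.subtype E) (b.sum_repr ⟨x, hx⟩)
      rw [Matrix.vecMul_eq_sum]
      rw [map_sum] at this
      exact this.symm
    have h2 : x = (fun k => x (I k)) ᵥ* R := by
      conv_lhs => rw [h1, hR, ← Matrix.vecMul_vecMul]
      congr 1
      ext k
      conv_rhs => rw [h1]
      rfl
    have hle : Module.finrank ℝ E ≤ Fintype.card n := by
      simpa using Submodule.finrank_le E
    calc |x i| = |∑ k, x (I k) * R k i| := congrArg abs (congrFun h2 i)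
      _ ≤ ∑ k, |x (I k) * R k i| := Finset.abs_sum_le_sum_abs _ _
      _ ≤ ∑ _k : Fin (Module.finrank ℝ E), B := by
        refine Finset.sum_le_sum fun k _ => ?_
        rw [abs_mul]
        calc |x (I k)| * |R k i| ≤ B * 1 :=
              mul_le_mul (hk _ (Finset.mem_image_of_mem _ (Finset.mem_univ k))) (hb k i)
                (abs_nonneg _) hB
          _ = B := mul_one B
      _ = (Module.finrank ℝ E : ℝ) * B := by simp
      _ ≤ _ := mul_le_mul_of_nonneg_right (by exact_mod_cast hle) hB

/-- Restriction of vectors to the coordinates in `J`. -/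
def restrictCoords (J : Finset n) : (n → ℝ) →ₗ[ℝ] (J → ℝ) := LinearMap.funLeft ℝ ℝ Subtype.val

theorem IsPivot.exists_extension [Nonempty n] {C : ℝ} (hC : 0 ≤ C) {E E' : Submodule ℝ (n → ℝ)}
    (hE : E ≤ E') {J : Finset n} (h : IsPivot C E J) :
    ∃ J', J ⊆ J' ∧ IsPivot (C + Fintype.card n * (1 + C)) E' J' := by
  -- A vector of `E'` is the sum of the vector of `E` with the same coordinates on `J` and of one
  -- vanishing on `J`, so the new pivots are those of the vectors of `E'` vanishing on `J`.
  obtain ⟨J₂, h₂⟩ := exists_isPivot (E' ⊓ LinearMap.ker (restrictCoords J))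
  have hbound : ∀ x ∈ E', ∀ B : ℝ, 0 ≤ B → (∀ k ∈ J ∪ J₂, |x k| ≤ B) →
      ∀ i, |x i| ≤ (C + Fintype.card n * (1 + C)) * B := by
    intro x hx B hB hk i
    have hinj : Function.Injective ((restrictCoords J).comp E.subtype) := by
      rw [← LinearMap.ker_eq_bot, LinearMap.ker_eq_bot']
      intro y hy
      apply Subtype.ext
      exact h.eq_zero y.2 fun k hkJ => congrFun hy ⟨k, hkJ⟩
    have hsurj : Function.Surjective ((restrictCoords J).comp E.subtype) :=
      (LinearMap.injective_iff_surjective_of_finrank_eq_finrank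
        (by rw [Module.finrank_pi, Fintype.card_coe, h.1])).1 hinj
    obtain ⟨y, hy⟩ := hsurj (restrictCoords J x)
    have hyx : ∀ k ∈ J, (y : n → ℝ) k = x k := fun k hkJ => congrFun hy ⟨k, hkJ⟩
    have hyb : ∀ k, |(y : n → ℝ) k| ≤ C * B := h.2 y y.2 B hB fun k hkJ => by
      rw [hyx k hkJ]; exact hk k (Finset.mem_union_left _ hkJ)
    have hmem : x - y ∈ E' ⊓ LinearMap.ker (restrictCoords J) := by
      refine ⟨E'.sub_mem hx (hE y.2), ?_⟩
      change restrictCoords J (x - y) = 0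
      rw [map_sub, sub_eq_zero]
      exact hy.symm
    have h3 := h₂.2 (x - y) hmem ((1 + C) * B) (by positivity) (fun k hkJ => by
      calc |(x - (y : n → ℝ)) k| ≤ |x k| + |(y : n → ℝ) k| := abs_sub _ _
        _ ≤ B + C * B := add_le_add (hk k (Finset.mem_union_right _ hkJ)) (hyb k)
        _ = (1 + C) * B := by ring) i
    calc |x i| = |(y : n → ℝ) i + (x - (y : n → ℝ)) i| := by simp
      _ ≤ |(y : n → ℝ) i| + |(x - (y : n → ℝ)) i| := abs_add_le _ _
      _ ≤ C * B + Fintype.card n * ((1 + C) * B) := add_le_add (hyb i) h3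
      _ = _ := by ring
  refine ⟨J ∪ J₂, Finset.subset_union_left, ?_, hbound⟩
  apply le_antisymm
  · refine (Finset.card_union_le _ _).trans ?_
    rw [h.1, h₂.1]
    have hdis : E ⊓ (E' ⊓ LinearMap.ker (restrictCoords J)) = ⊥ := by
      rw [eq_bot_iff]
      rintro x ⟨hx, -, hx'⟩
      exact h.eq_zero hx fun k hkJ => congrFun hx' ⟨k, hkJ⟩
    have h4 := Submodule.finrank_sup_add_finrank_inf_eq E
      (E' ⊓ LinearMap.ker (restrictCoords J))
    rw [hdis, finrank_bot, add_zero] at h4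
    rw [← h4]
    exact Submodule.finrank_mono (sup_le hE inf_le_left)
  · have hinj : Function.Injective ((restrictCoords (J ∪ J₂)).comp E'.subtype) := by
      rw [← LinearMap.ker_eq_bot, LinearMap.ker_eq_bot']
      intro y hy
      apply Subtype.ext
      ext i
      have := hbound y y.2 0 le_rfl (fun k hkJ => by
        have : (y : n → ℝ) k = 0 := congrFun hy ⟨k, hkJ⟩
        rw [this, abs_zero]) i
      rw [mul_zero] at this
      simpa using this
    have := LinearMap.finrank_le_finrank_of_injective hinj
    rwa [Module.finrank_pi, Fintype.card_coe] at this

/-- The constant for the pivots of a chain of length `j`. -/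
def pivotConst (N : ℕ) : ℕ → ℝ
  | 0 => N
  | j + 1 => pivotConst N j + N * (1 + pivotConst N j)

theorem pivotConst_nonneg (N j : ℕ) : 0 ≤ pivotConst N j := by
  induction j with
  | zero => exact Nat.cast_nonneg N
  | succ j ih => simp only [pivotConst]; positivity

theorem pivotConst_mono (N : ℕ) : Monotone (pivotConst N) := by
  refine monotone_nat_of_le_succ fun j => ?_
  have := pivotConst_nonneg N j
  simp only [pivotConst]
  have : (0 : ℝ) ≤ N * (1 + pivotConst N j) := by positivity
  linarith

theorem one_le_pivotConst {N : ℕ} (hN : 1 ≤ N) (j : ℕ) : 1 ≤ pivotConst N j :=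
  le_trans (by simpa [pivotConst] using hN) (pivotConst_mono N (Nat.zero_le j))

theorem exists_monotone_isPivot [Nonempty n] {E : ℕ → Submodule ℝ (n → ℝ)} (hE : Monotone E) :
    ∃ J : ℕ → Finset n, Monotone J ∧ ∀ j, IsPivot (pivotConst (Fintype.card n) j) (E j) (J j) := by
  let f : ∀ j, {J : Finset n // IsPivot (pivotConst (Fintype.card n) j) (E j) J} := fun j =>
    Nat.rec ⟨(exists_isPivot (E 0)).choose, (exists_isPivot (E 0)).choose_spec⟩
      (fun j J =>
        ⟨(J.2.exists_extension (pivotConst_nonneg _ _) (hE (Nat.le_succ j))).choose,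
          (J.2.exists_extension (pivotConst_nonneg _ _) (hE (Nat.le_succ j))).choose_spec.2⟩) j
  refine ⟨fun j => (f j).1, monotone_nat_of_le_succ fun j => ?_, fun j => (f j).2⟩
  exact ((f j).2.exists_extension (pivotConst_nonneg _ _) (hE (Nat.le_succ j))).choose_spec.1

/-- The subspaces of a chain have nested sets of pivots. -/
theorem exists_isPivot_of_isChain [Nonempty n] {s : Set (Submodule ℝ (n → ℝ))}
    (hs : IsChain (· ≤ ·) s) :
    ∃ J : ℕ → Finset n, Monotone J ∧
      ∀ E ∈ s, IsPivot (pivotConst (Fintype.card n) (Fintype.card n)) E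
        (J (Module.finrank ℝ E)) := by
  -- Indexing the chain by dimension: a member `E` is recovered as the value of `F` at its own
  -- dimension.
  let F : ℕ → Submodule ℝ (n → ℝ) := fun j => sSup {E | E ∈ s ∧ Module.finrank ℝ E ≤ j}
  have hF : Monotone F := fun i j hij => sSup_le_sSup fun E hE => ⟨hE.1, hE.2.trans hij⟩
  obtain ⟨J, hJ, hp⟩ := exists_monotone_isPivot hF
  refine ⟨J, hJ, fun E hE => ?_⟩
  have hEF : F (Module.finrank ℝ E) = E := by
    apply le_antisymm
    · refine sSup_le fun E' hE' => ?_
      rcases hs.total hE'.1 hE with h | h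
      · exact h
      · exact (Submodule.eq_of_le_of_finrank_le h hE'.2).ge
    · exact le_sSup ⟨hE, le_rfl⟩
  have := hp (Module.finrank ℝ E)
  rw [hEF] at this
  refine this.mono (pivotConst_mono _ ?_)
  simpa using Submodule.finrank_le E

theorem det_submatrix_mul_diagonal (W : Matrix ι n ℝ) (w : n → ℝ) (I : ι → n) :
    ((W * Matrix.diagonal w).submatrix id I).det = (∏ i, w (I i)) * (W.submatrix id I).det := by
  rw [← Matrix.det_mul_row]
  congr 1
  ext i j
  simp [mul_comm]

theorem exp_mul_maxMinor_le [Nonempty n] (W : Matrix ι n ℝ) {z : n → ℝ} {B : ℝ}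
    (hz : ∀ i, |z i| ≤ B) :
    Real.exp (-(Fintype.card ι * B)) * maxMinor W ≤
      maxMinor (W * Matrix.diagonal fun i => Real.exp (z i)) := by
  obtain ⟨I, hI⟩ := exists_abs_det_eq_maxMinor W
  refine le_trans ?_ (abs_det_submatrix_le_maxMinor _ I)
  rw [det_submatrix_mul_diagonal, abs_mul, hI, ← Real.exp_sum, Real.abs_exp]
  refine mul_le_mul_of_nonneg_right (Real.exp_le_exp.2 ?_) (maxMinor_nonneg W)
  calc -(Fintype.card ι * B) = ∑ _i : ι, -B := by simp
    _ ≤ ∑ i, z (I i) := Finset.sum_le_sum fun i _ => (abs_le.1 (hz _)).1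

/-- The minor on the pivot columns is within a constant of the largest one, and the diagonal matrix
multiplies it by exactly the exponential of the sum over `J`. Thus a positive sum over the pivots
expands the covolume. -/
theorem IsPivot.exp_mul_maxMinor_le [Nonempty n] {C : ℝ} {E : Submodule ℝ (n → ℝ)} {J : Finset n}
    (h : IsPivot C E J) {W : Matrix ι n ℝ} (hW : LinearIndependent ℝ W.row)
    (hE : Submodule.span ℝ (Set.range W.row) = E) (z : n → ℝ) :
    Real.exp (∑ i ∈ J, z i) * maxMinor W ≤
      ((Fintype.card ι).factorial * C ^ Fintype.card ι) *
        maxMinor (W * Matrix.diagonal fun i => Real.exp (z i)) := by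
  have hcard : Fintype.card ι = Fintype.card J := by
    rw [Fintype.card_coe, h.1, ← hE, finrank_span_eq_card hW]
  let e : ι ≃ J := Fintype.equivOfCardEq hcard
  let I : ι → n := fun i => e i
  have hmem : ∀ c : ι → ℝ, c ᵥ* W ∈ E := by
    intro c
    rw [← hE, Matrix.vecMul_eq_sum]
    exact Submodule.sum_mem _ fun i _ =>
      Submodule.smul_mem _ _ (Submodule.subset_span ⟨i, rfl⟩)
  have hIJ : ∀ x : n → ℝ, ∀ p : ℝ → Prop, (∀ k, p (x (I k))) → ∀ j ∈ J, p (x j) := by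
    intro x p hp j hj
    have := hp (e.symm ⟨j, hj⟩)
    simpa [I] using this
  have hu : IsUnit (W.submatrix id I) := by
    rw [← Matrix.vecMul_injective_iff_isUnit]
    intro a b hab
    have h0 : (a - b) ᵥ* W = 0 := by
      refine h.eq_zero (hmem _) (hIJ _ (· = 0) fun k => ?_)
      have := congrFun hab k
      rw [Matrix.sub_vecMul, Pi.sub_apply, sub_eq_zero]
      exact this
    rw [← Matrix.vecMul_injective_iff] at hW
    exact sub_eq_zero.1 (hW (by simpa using h0))
  have hud : IsUnit (W.submatrix id I).det := (Matrix.isUnit_iff_isUnit_det _).1 hu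
  set R : Matrix ι n ℝ := (W.submatrix id I)⁻¹ * W with hR
  have hWR : W = W.submatrix id I * R := by
    rw [hR, ← Matrix.mul_assoc, Matrix.mul_nonsing_inv _ hud, Matrix.one_mul]
  have hRI : R.submatrix id I = 1 := by
    have : R.submatrix id I = (W.submatrix id I)⁻¹ * W.submatrix id I := rfl
    rw [this, Matrix.nonsing_inv_mul _ hud]
  have hRb : ∀ k j, |R k j| ≤ C := by
    intro k j
    have h1 : R k ∈ E := hmem ((W.submatrix id I)⁻¹ k)
    have := h.2 (R k) h1 1 zero_le_one (hIJ _ (|·| ≤ 1) fun i => by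
      have h2 : R k (I i) = (1 : Matrix ι ι ℝ) k i := by rw [← hRI]; rfl
      rw [h2, Matrix.one_apply]
      split_ifs <;> simp) j
    simpa using this
  have h1 : maxMinor W ≤
      |(W.submatrix id I).det| * ((Fintype.card ι).factorial * C ^ Fintype.card ι) := by
    conv_lhs => rw [hWR, maxMinor_mul]
    exact mul_le_mul_of_nonneg_left (maxMinor_le fun K => abs_det_le fun i j => hRb _ _)
      (abs_nonneg _)
  have h2 := abs_det_submatrix_le_maxMinor (W * Matrix.diagonal fun i => Real.exp (z i)) I
  rw [det_submatrix_mul_diagonal, abs_mul, ← Real.exp_sum, Real.abs_exp] at h2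
  have h3 : ∑ i, z (I i) = ∑ i ∈ J, z i := by
    rw [← Finset.sum_coe_sort J z]
    exact e.sum_comp fun j => z j
  rw [h3] at h2
  have hC : 0 ≤ ((Fintype.card ι).factorial * C ^ Fintype.card ι : ℝ) := by
    rcases isEmpty_or_nonempty ι with hι | ⟨⟨i⟩⟩
    · simp
    · have : 0 ≤ C := (abs_nonneg _).trans (hRb i (I i))
      positivity
  calc _ ≤ Real.exp (∑ i ∈ J, z i) * (|(W.submatrix id I).det| *
        ((Fintype.card ι).factorial * C ^ Fintype.card ι)) :=
        mul_le_mul_of_nonneg_left h1 (Real.exp_nonneg _)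
    _ = ((Fintype.card ι).factorial * C ^ Fintype.card ι) *
        (Real.exp (∑ i ∈ J, z i) * |(W.submatrix id I).det|) := by ring
    _ ≤ _ := mul_le_mul_of_nonneg_left h2 hC

/-- A direction in which the coordinates on every set of an increasing family have positive sum. -/
theorem exists_direction {d : ℕ} (hd : 2 ≤ d) {J : ℕ → Finset (Fin d)} (hJ : Monotone J) :
    ∃ Z : cartan d, (∀ i, |Z.1 i| ≤ d + 1) ∧
      ∀ j ≤ d, 0 < (J j).card → (J j).card < d → 1 / 2 ≤ ∑ i ∈ J j, Z.1 i := by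
  have hd0 : (0 : ℝ) < d := by exact_mod_cast (by omega : 0 < d)
  have hcard : ∀ j, ((J j).card : ℝ) ≤ d := fun j => by
    exact_mod_cast (by simpa using Finset.card_le_univ (J j))
  -- The indicator of `J j` projected to the zero-sum vectors. For nested sets these projections
  -- have nonnegative pairings, so their sum over j works for every set at once.
  let x : ℕ → Fin d → ℝ := fun j i => (if i ∈ J j then 1 else 0) - (J j).card / d
  have hsum : ∀ (s : Finset (Fin d)) j, ∑ i ∈ s, x j i =
      ((s ∩ J j).card : ℝ) - s.card * ((J j).card / d) := by
    intro s j
    simp only [x, Finset.sum_sub_distrib, Finset.sum_const, nsmul_eq_mul]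
    rw [Finset.sum_ite_mem]
    simp
  let Z : EuclideanSpace ℝ (Fin d) := WithLp.toLp 2 fun i => ∑ j ∈ Finset.range (d + 1), x j i
  have hZ : Z ∈ cartan d := by
    change ∑ i, ∑ j ∈ Finset.range (d + 1), x j i = 0
    rw [Finset.sum_comm]
    refine Finset.sum_eq_zero fun j _ => ?_
    rw [hsum]
    simp
    field_simp
    simp
  refine ⟨⟨Z, hZ⟩, fun i => ?_, fun j hj h0 h1 => ?_⟩
  · change |∑ j ∈ Finset.range (d + 1), x j i| ≤ d + 1
    refine (Finset.abs_sum_le_sum_abs _ _).trans ?_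
    calc _ ≤ ∑ _j ∈ Finset.range (d + 1), (1 : ℝ) := by
          refine Finset.sum_le_sum fun j _ => ?_
          have h1 : ((J j).card : ℝ) / d ≤ 1 := (div_le_one hd0).2 (hcard j)
          have h2 : 0 ≤ ((J j).card : ℝ) / d := by positivity
          simp only [x]
          rw [abs_le]
          split_ifs <;> constructor <;> linarith
      _ = _ := by simp
  · change 1 / 2 ≤ ∑ i ∈ J j, ∑ k ∈ Finset.range (d + 1), x k i
    rw [Finset.sum_comm]
    have hterm : ∀ k, 0 ≤ ∑ i ∈ J j, x k i := by
      intro k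
      rw [hsum]
      rcases le_total k j with h | h
      · rw [Finset.inter_eq_right.2 (hJ h)]
        have := hcard j
        have h3 : ((J j).card : ℝ) * ((J k).card / d) ≤ d * ((J k).card / d) :=
          mul_le_mul_of_nonneg_right this (by positivity)
        rw [mul_div_cancel₀ _ hd0.ne'] at h3
        linarith
      · rw [Finset.inter_eq_left.2 (hJ h)]
        have h1 : ((J k).card : ℝ) / d ≤ 1 := (div_le_one hd0).2 (hcard k)
        have : ((J j).card : ℝ) * ((J k).card / d) ≤ (J j).card * 1 :=
          mul_le_mul_of_nonneg_left h1 (by positivity)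
        linarith
    refine le_trans ?_ (Finset.single_le_sum (fun k _ => hterm k)
      (Finset.mem_range.2 (Nat.lt_succ_of_le hj)))
    -- With a the cardinality of `J j`, the diagonal term is a(d - a)/d, and a(d - a) ≥ d - 1 ≥ d/2.
    rw [hsum, Finset.inter_self]
    have ha : (1 : ℝ) ≤ (J j).card := by exact_mod_cast h0
    have hb : ((J j).card : ℝ) ≤ d - 1 := by
      have : (J j).card + 1 ≤ d := h1
      have : ((J j).card : ℝ) + 1 ≤ d := by exact_mod_cast this
      linarith
    have hd2 : (2 : ℝ) ≤ d := by exact_mod_cast hd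
    rw [mul_div_assoc', le_sub_iff_add_le, ← le_sub_iff_add_le', div_le_iff₀ hd0]
    nlinarith

end Pivots

end FlatTori

namespace FlatTori

/-! ### Integer points of subspaces and bases adapted to an intersection -/

section IntegerPoints

variable {ι κ n : Type*} [Fintype ι] [DecidableEq ι] [Fintype κ] [DecidableEq κ]
  [Fintype n] [DecidableEq n]

/-- The inclusion of `ℤⁿ` in `ℝⁿ`. -/
def intCastLM (n : Type*) : (n → ℤ) →ₗ[ℤ] (n → ℝ) := (Int.castAddHom ℝ).toIntLinearMap.compLeft n

/-- The integer points of a subspace. -/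
def intPoints (E : Submodule ℝ (n → ℝ)) : Submodule ℤ (n → ℤ) :=
  (E.restrictScalars ℤ).comap (intCastLM n)

theorem mem_intPoints {E : Submodule ℝ (n → ℝ)} {x : n → ℤ} :
    x ∈ intPoints E ↔ (fun i => (x i : ℝ)) ∈ E := Iff.rfl

/-- The real subspace spanned by the rows of an integer matrix. -/
def realSpan (V : Matrix ι n ℤ) : Submodule ℝ (n → ℝ) :=
  Submodule.span ℝ (Set.range (V.map (Int.cast : ℤ → ℝ)).row)

theorem row_mem_intPoints (V : Matrix ι n ℤ) (i : ι) : V i ∈ intPoints (realSpan V) :=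
  Submodule.subset_span ⟨i, rfl⟩

theorem exists_basis_extension {E₁ E : Submodule ℝ (n → ℝ)} (h : E₁ ≤ E) {a : ℕ}
    (bA : Module.Basis (Fin a) ℤ (intPoints E₁)) :
    ∃ (b : ℕ) (c : Module.Basis (Fin a ⊕ Fin b) ℤ (intPoints E)),
      ∀ i, (c (Sum.inl i) : n → ℤ) = bA i := by
  have hle : intPoints E₁ ≤ intPoints E := Submodule.comap_mono h
  let bW := bA.map (Submodule.submoduleOfEquivOfLe hle).symm
  -- Integer points of a real subspace form a saturated subgroup, so the quotient is free and a
  -- basis of it can be lifted.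
  have htf : Module.IsTorsionFree ℤ (intPoints E ⧸ (intPoints E₁).submoduleOf (intPoints E)) := by
    apply Module.IsTorsionFree.of_smul_eq_zero
    intro r m hrm
    induction m using Submodule.Quotient.induction_on with
    | H x =>
      rw [or_iff_not_imp_left]
      intro hr
      rw [← Submodule.Quotient.mk_smul, Submodule.Quotient.mk_eq_zero] at hrm
      rw [Submodule.Quotient.mk_eq_zero]
      have h1 : (fun i => ((r • (x : n → ℤ)) i : ℝ)) ∈ E₁ := hrm
      have h2 : (fun i => ((r • (x : n → ℤ)) i : ℝ)) = (r : ℝ) • fun i => ((x : n → ℤ) i : ℝ) := by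
        ext i; simp
      rw [h2] at h1
      exact (Submodule.smul_mem_iff E₁ (by exact_mod_cast hr)).1 h1
  let bQ := Module.finBasis ℤ (intPoints E ⧸ (intPoints E₁).submoduleOf (intPoints E))
  refine ⟨_, Module.Basis.sumQuot bW bQ, fun i => ?_⟩
  rw [Module.Basis.sumQuot_inl]
  rfl

theorem linearIndependent_coe_basis {E : Submodule ℝ (n → ℝ)}
    (b : Module.Basis κ ℤ (intPoints E)) :
    LinearIndependent ℤ (Matrix.of fun i => (b i : n → ℤ)).row :=
  b.linearIndependent.map' (intPoints E).subtype (Submodule.ker_subtype _)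

/-- Passing to the saturation costs an integer matrix, whose determinant is at least 1 in absolute
value when nonzero. So covolumes only decrease. -/
theorem exists_eq_mul_basis {V : Matrix ι n ℤ} (hV : LinearIndependent ℤ V.row)
    (b : Module.Basis κ ℤ (intPoints (realSpan V))) :
    ∃ (e : ι ≃ κ) (U : Matrix ι ι ℤ),
      V = U * (Matrix.of fun i => (b i : n → ℤ)).submatrix e id := by
  have h1 : Fintype.card ι ≤ Fintype.card κ := by
    have h : LinearIndependent ℤ (fun i => (⟨V i, row_mem_intPoints V i⟩ :
        intPoints (realSpan V))) :=
      LinearIndependent.of_comp (intPoints (realSpan V)).subtype hV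
    have := h.fintype_card_le_finrank
    rwa [Module.finrank_eq_card_basis b] at this
  have h2 : Fintype.card κ ≤ Fintype.card ι := by
    have hli := linearIndependent_row_intCast (linearIndependent_coe_basis b)
    have h : LinearIndependent ℝ (fun i => (⟨fun j => ((b i : n → ℤ) j : ℝ), (b i).2⟩ :
        realSpan V)) :=
      LinearIndependent.of_comp (realSpan V).subtype hli
    have := h.fintype_card_le_finrank
    rwa [realSpan, finrank_span_eq_card (linearIndependent_row_intCast hV)] at this
  let e : ι ≃ κ := Fintype.equivOfCardEq (le_antisymm h1 h2)
  refine ⟨e, Matrix.of fun i j => b.repr ⟨V i, row_mem_intPoints V i⟩ (e j), ?_⟩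
  ext i k
  have := congrFun (congrArg (Submodule.subtype _) (b.sum_repr ⟨V i, row_mem_intPoints V i⟩)) k
  rw [map_sum] at this
  rw [Matrix.mul_apply]
  simp only [Submodule.subtype_apply, map_smul, Finset.sum_apply, Pi.smul_apply,
    smul_eq_mul] at this
  rw [← this, ← e.sum_comp]
  rfl

/-- Two families of integer vectors have bases of their saturations with a common part spanning
the intersection. -/
theorem exists_adapted_bases {V : Matrix ι n ℤ} {V' : Matrix κ n ℤ}
    (hV : LinearIndependent ℤ V.row) (hV' : LinearIndependent ℤ V'.row) :
    ∃ (a b c : ℕ) (A : Matrix (Fin a) n ℤ) (B : Matrix (Fin b) n ℤ) (C : Matrix (Fin c) n ℤ)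
      (e : ι ≃ Fin a ⊕ Fin b) (e' : κ ≃ Fin a ⊕ Fin c) (U : Matrix ι ι ℤ) (U' : Matrix κ κ ℤ),
      LinearIndependent ℤ (fromRows (fromRows A B) C).row ∧
      V = U * (fromRows A B).submatrix e id ∧ V' = U' * (fromRows A C).submatrix e' id := by
  let bA := Module.finBasis ℤ (intPoints (realSpan V ⊓ realSpan V'))
  obtain ⟨b, cB, hB⟩ := exists_basis_extension (inf_le_left : _ ≤ realSpan V) bA
  obtain ⟨c, cC, hC⟩ := exists_basis_extension (inf_le_right : _ ≤ realSpan V') bA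
  obtain ⟨e, U, hU⟩ := exists_eq_mul_basis hV cB
  obtain ⟨e', U', hU'⟩ := exists_eq_mul_basis hV' cC
  let A : Matrix _ n ℤ := Matrix.of fun i => (bA i : n → ℤ)
  let B : Matrix _ n ℤ := Matrix.of fun i => (cB (Sum.inr i) : n → ℤ)
  let C : Matrix _ n ℤ := Matrix.of fun i => (cC (Sum.inr i) : n → ℤ)
  have hAB : (Matrix.of fun i => (cB i : n → ℤ)) = fromRows A B := by
    ext (i | i) j
    · simp [A, hB]
    · rfl
  have hAC : (Matrix.of fun i => (cC i : n → ℤ)) = fromRows A C := by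
    ext (i | i) j
    · simp [A, hC]
    · rfl
  rw [hAB] at hU
  rw [hAC] at hU'
  refine ⟨_, b, c, A, B, C, e, e', U, U', ?_, hU, hU'⟩
  have iAB := linearIndependent_coe_basis cB
  have iAC := linearIndependent_coe_basis cC
  rw [hAB] at iAB
  rw [hAC] at iAC
  have iAC' := linearIndependent_sum.1 iAC
  refine linearIndependent_sum.2 ⟨iAB, iAC'.2.1, ?_⟩
  -- A vector in the spans of both `fromRows A B` and `C` is an integer point of the intersection,
  -- hence in the span of `A`, which meets that of `C` trivially.
  rw [Submodule.disjoint_def]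
  intro x hx hx'
  refine Submodule.disjoint_def.1 iAC'.2.2 x ?_ hx'
  have h1 : x ∈ intPoints (realSpan V) := by
    refine Submodule.span_le.2 ?_ hx
    rintro _ ⟨i, rfl⟩
    have : (fromRows A B).row i = cB i := by rw [← hAB]; rfl
    change (fromRows A B).row i ∈ _
    rw [this]
    exact (cB i).2
  have h2 : x ∈ intPoints (realSpan V') := by
    refine Submodule.span_le.2 ?_ hx'
    rintro _ ⟨i, rfl⟩
    exact (cC (Sum.inr i)).2
  have h3 : x ∈ intPoints (realSpan V ⊓ realSpan V') := ⟨h1, h2⟩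
  have h4 := congrArg (Submodule.subtype _) (bA.sum_repr ⟨x, h3⟩)
  rw [map_sum] at h4
  change _ = x at h4
  rw [← h4]
  exact Submodule.sum_mem _ fun i _ => Submodule.smul_mem _ _ (Submodule.subset_span ⟨i, rfl⟩)

theorem det_ne_zero_of_linearIndependent_mul {U : Matrix ι ι ℤ} {W : Matrix ι n ℤ}
    (h : LinearIndependent ℤ (U * W).row) : U.det ≠ 0 := by
  intro h0
  obtain ⟨v, hv, hvU⟩ := Matrix.exists_vecMul_eq_zero_iff.2 h0
  rw [← Matrix.vecMul_injective_iff] at h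
  refine hv (h ?_)
  simp only [← Matrix.vecMul_vecMul, hvU, Matrix.zero_vecMul]

end IntegerPoints

/-! ### Sublattices of a unimodular lattice -/

section LatticeRows

variable {ι κ l : Type*} [Fintype ι] [DecidableEq ι] [Fintype κ] [DecidableEq κ]
  [Fintype l] [DecidableEq l] {d : ℕ}

/-- The vectors of the lattice `ℤᵈ h` with the coordinate vectors in the rows of `V`. -/
def latRows (V : Matrix ι (Fin d) ℤ) (h : G d) : Matrix ι (Fin d) ℝ :=
  V.map (Int.cast : ℤ → ℝ) * mat h

theorem isUnit_mat (h : G d) : IsUnit (mat h) := by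
  rw [Matrix.isUnit_iff_isUnit_det]
  have : (mat h).det = 1 := h.2
  rw [this]
  exact isUnit_one

theorem linearIndependent_latRows {V : Matrix ι (Fin d) ℤ} (hV : LinearIndependent ℤ V.row)
    (h : G d) : LinearIndependent ℝ (latRows V h).row := by
  have h1 := linearIndependent_row_intCast hV
  rw [← Matrix.vecMul_injective_iff] at h1 ⊢
  intro x y hxy
  simp only [latRows, ← Matrix.vecMul_vecMul] at hxy
  exact h1 (Matrix.vecMul_injective_iff_isUnit.2 (isUnit_mat h) hxy)

theorem latRows_mul (U : Matrix ι ι ℤ) (V : Matrix ι (Fin d) ℤ) (h : G d) :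
    latRows (U * V) h = U.map (Int.cast : ℤ → ℝ) * latRows V h := by
  have : (U * V).map (Int.cast : ℤ → ℝ) =
      U.map (Int.cast : ℤ → ℝ) * V.map (Int.cast : ℤ → ℝ) :=
    Matrix.map_mul (f := Int.castRingHom ℝ)
  rw [latRows, latRows, this, Matrix.mul_assoc]

theorem latRows_fromRows (V : Matrix ι (Fin d) ℤ) (V' : Matrix κ (Fin d) ℤ) (h : G d) :
    latRows (fromRows V V') h = fromRows (latRows V h) (latRows V' h) := by
  rw [latRows, fromRows_map, fromRows_mul]
  rfl

theorem latRows_mul_expA (V : Matrix ι (Fin d) ℤ) (h : G d) (Z : cartan d) :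
    latRows V (h * expA Z) = latRows V h * Matrix.diagonal fun i => Real.exp (Z.1 i) := by
  rw [latRows, mat_mul, ← Matrix.mul_assoc]
  rfl

theorem one_le_abs_det_intCast {U : Matrix ι ι ℤ} (hU : U.det ≠ 0) :
    1 ≤ |(U.map (Int.cast : ℤ → ℝ)).det| := by
  have : (U.map (Int.cast : ℤ → ℝ)).det = (U.det : ℝ) :=
    ((Int.castRingHom ℝ).map_det U).symm
  rw [this]
  exact_mod_cast Int.one_le_abs hU

theorem maxMinor_latRows_le_mul {U : Matrix ι ι ℤ} (hU : U.det ≠ 0) (V : Matrix ι (Fin d) ℤ)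
    (h : G d) : maxMinor (latRows V h) ≤ maxMinor (latRows (U * V) h) := by
  rw [latRows_mul, maxMinor_mul]
  exact le_mul_of_one_le_left (maxMinor_nonneg _) (one_le_abs_det_intCast hU)

theorem maxMinor_latRows_reindex (e : ι ≃ κ) (V : Matrix κ (Fin d) ℤ) (h : G d) :
    maxMinor (latRows (V.submatrix e id) h) = maxMinor (latRows V h) :=
  maxMinor_reindex e (latRows V h)

theorem card_le_of_linearIndependent {V : Matrix ι (Fin d) ℤ} (hV : LinearIndependent ℤ V.row) :
    Fintype.card ι ≤ d := by
  simpa using (linearIndependent_row_intCast hV).fintype_card_le_finrank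

/-- In full rank the only minor, up to sign, is a nonzero integer determinant. -/
theorem one_le_maxMinor_latRows {V : Matrix ι (Fin d) ℤ} (hV : LinearIndependent ℤ V.row)
    (hc : Fintype.card ι = d) (h : G d) : 1 ≤ maxMinor (latRows V h) := by
  let e : ι ≃ Fin d := Fintype.equivFinOfCardEq hc
  have h1 : LinearIndependent ℤ (V.submatrix e.symm id).row := hV.comp _ e.symm.injective
  have h2 : (V.submatrix e.symm id).det ≠ 0 := by
    apply det_ne_zero_of_linearIndependent_mul (W := (1 : Matrix (Fin d) (Fin d) ℤ))
    rwa [Matrix.mul_one]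
  have h3 : (mat h).det = 1 := h.2
  rw [← maxMinor_latRows_reindex e.symm, maxMinor_square, latRows, Matrix.det_mul, h3, mul_one]
  exact one_le_abs_det_intCast h2

/-- The real span of lattice vectors. -/
def latSpan (V : Matrix ι (Fin d) ℤ) (h : G d) : Submodule ℝ (Fin d → ℝ) :=
  Submodule.span ℝ (Set.range (latRows V h).row)

theorem finrank_latSpan {V : Matrix ι (Fin d) ℤ} (hV : LinearIndependent ℤ V.row) (h : G d) :
    Module.finrank ℝ (latSpan V h) = Fintype.card ι :=
  finrank_span_eq_card (linearIndependent_latRows hV h)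

theorem span_row_mul_le (U : Matrix κ ι ℝ) (W : Matrix ι (Fin d) ℝ) :
    Submodule.span ℝ (Set.range (U * W).row) ≤ Submodule.span ℝ (Set.range W.row) := by
  rw [Submodule.span_le]
  rintro _ ⟨i, rfl⟩
  have : (U * W).row i = U i ᵥ* W := rfl
  rw [SetLike.mem_coe, this, Matrix.vecMul_eq_sum]
  exact Submodule.sum_mem _ fun j _ => Submodule.smul_mem _ _ (Submodule.subset_span ⟨j, rfl⟩)

theorem latSpan_mul_reindex_le (U : Matrix ι ι ℤ) (e : ι ≃ κ) (V : Matrix κ (Fin d) ℤ) (h : G d) :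
    latSpan (U * V.submatrix e id) h ≤ latSpan V h := by
  rw [latSpan, latRows_mul]
  refine (span_row_mul_le _ _).trans (Submodule.span_mono ?_)
  rintro _ ⟨i, rfl⟩
  exact ⟨e i, rfl⟩

end LatticeRows

end FlatTori

namespace FlatTori

/-! ### Climbing: improving the smallest weighted covolume by bounded steps -/

variable {d : ℕ}

/-- The weight of the covolumes of sublattices of rank `k`. -/
def rankWeight (d k : ℕ) : ℝ := k * (d - k)

/-- The covolumes of the sublattices of `ℤᵈ h`, weighted by a strictly concave function of the
rank, are at least `exp (-β)`. -/
def WeightedCovolGE (θ β : ℝ) (h : G d) : Prop :=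
  ∀ (ι : Type) [Fintype ι] [DecidableEq ι] (V : Matrix ι (Fin d) ℤ), LinearIndependent ℤ V.row →
    Real.exp (-β) ≤ maxMinor (latRows V h) * Real.exp (θ * rankWeight d (Fintype.card ι))

/-- Sublattices whose weighted covolumes are almost as small as possible span nested subspaces. -/
theorem latSpan_le_or_le {θ β : ℝ} {h : G d} (hθ : (d.factorial : ℝ) < Real.exp θ)
    (hd : 0 < d) (hh : WeightedCovolGE θ β h) {ι κ : Type} [Fintype ι] [DecidableEq ι] [Fintype κ]
    [DecidableEq κ] {V : Matrix ι (Fin d) ℤ} {V' : Matrix κ (Fin d) ℤ}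
    (hV : LinearIndependent ℤ V.row) (hV' : LinearIndependent ℤ V'.row)
    (h1 : maxMinor (latRows V h) * Real.exp (θ * rankWeight d (Fintype.card ι)) ≤
      Real.exp (-β + θ / 2))
    (h2 : maxMinor (latRows V' h) * Real.exp (θ * rankWeight d (Fintype.card κ)) ≤
      Real.exp (-β + θ / 2)) :
    latSpan V h ≤ latSpan V' h ∨ latSpan V' h ≤ latSpan V h := by
  have : Nonempty (Fin d) := ⟨⟨0, hd⟩⟩
  obtain ⟨a, b, c, A, B, C, e, e', U, U', hABC, rfl, rfl⟩ := exists_adapted_bases hV hV'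
  have hU := det_ne_zero_of_linearIndependent_mul hV
  have hU' := det_ne_zero_of_linearIndependent_mul hV'
  have hle : ∀ {m : ℕ} (D : Matrix (Fin m) (Fin d) ℤ),
      latSpan A h ≤ latSpan (fromRows A D) h := fun D => by
    refine Submodule.span_mono ?_
    rintro _ ⟨i, rfl⟩
    exact ⟨Sum.inl i, rfl⟩
  have hspan : ∀ {μ : Type} [Fintype μ] [DecidableEq μ] {m : ℕ} (D : Matrix (Fin m) (Fin d) ℤ)
      (U : Matrix μ μ ℤ) (e : μ ≃ Fin a ⊕ Fin m) (_ : U.det ≠ 0)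
      (_ : LinearIndependent ℤ (U * (fromRows A D).submatrix e id).row)
      (_ : LinearIndependent ℤ (fromRows A D).row),
      latSpan (U * (fromRows A D).submatrix e id) h = latSpan (fromRows A D) h := by
    intro μ _ _ m D U e hU hl hl'
    refine Submodule.eq_of_le_of_finrank_eq (latSpan_mul_reindex_le U e _ h) ?_
    rw [finrank_latSpan hl, finrank_latSpan hl', Fintype.card_congr e]
  have iAB : LinearIndependent ℤ (fromRows A B).row := hABC.comp Sum.inl Sum.inl_injective
  have iAC : LinearIndependent ℤ (fromRows A C).row :=
    hABC.comp (Sum.elim (Sum.inl ∘ Sum.inl) Sum.inr) (by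
      rintro (i | i) (j | j) hij <;> simp_all) |> fun hl => by
      convert hl using 1
      ext (i | i) j <;> rfl
  have iA : LinearIndependent ℤ A.row := iAB.comp Sum.inl Sum.inl_injective
  have hemp : ∀ {m : ℕ} (D : Matrix (Fin m) (Fin d) ℤ), m = 0 →
      latSpan (fromRows A D) h ≤ latSpan A h := by
    rintro m D rfl
    refine Submodule.span_mono ?_
    rintro _ ⟨i | i, rfl⟩
    · exact ⟨i, rfl⟩
    · exact i.elim0
  rw [hspan B U e hU hV iAB, hspan C U' e' hU' hV' iAC]
  rcases Nat.eq_zero_or_pos b with hb | hb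
  · exact Or.inl ((hemp B hb).trans (hle C))
  rcases Nat.eq_zero_or_pos c with hc | hc
  · exact Or.inr ((hemp C hc).trans (hle B))
  exfalso
  have m1 := maxMinor_latRows_le_mul hU ((fromRows A B).submatrix e id) h
  have m2 := maxMinor_latRows_le_mul hU' ((fromRows A C).submatrix e' id) h
  rw [maxMinor_latRows_reindex] at m1 m2
  have g1 := hh _ A iA
  have g2 := hh _ _ hABC
  have hsub := maxMinor_submodular (A := latRows A h) (B := latRows B h) (C := latRows C h) (by
    rw [← latRows_fromRows, ← latRows_fromRows]
    exact linearIndependent_latRows hABC h)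
  rw [← latRows_fromRows, ← latRows_fromRows, ← latRows_fromRows] at hsub
  have hcard := card_le_of_linearIndependent hABC
  have hfac : ((Fintype.card ((Fin a ⊕ Fin b) ⊕ Fin c)).factorial : ℝ) ≤ d.factorial := by
    exact_mod_cast Nat.factorial_le hcard
  -- Strict concavity of the weight: the defect is 2bc, at least 2 when neither span contains the
  -- other. This gain of 2θ exceeds the slack θ allowed by `h1` and `h2` together with the constant
  -- d! of submodularity.
  have hw : rankWeight d (Fintype.card (Fin a)) +
      rankWeight d (Fintype.card ((Fin a ⊕ Fin b) ⊕ Fin c)) =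
      rankWeight d (Fintype.card ι) + rankWeight d (Fintype.card κ) - 2 * (b * c) := by
    rw [Fintype.card_congr e, Fintype.card_congr e']
    simp only [rankWeight, Fintype.card_sum, Fintype.card_fin]
    push_cast
    ring
  have hθ0 : 0 < θ := by
    rw [← Real.exp_lt_exp, Real.exp_zero]
    exact lt_of_le_of_lt (by exact_mod_cast Nat.one_le_iff_ne_zero.2 (Nat.factorial_ne_zero d)) hθ
  have hbc : (1 : ℝ) ≤ b * c := by exact_mod_cast Nat.mul_pos hb hc
  set X := maxMinor (latRows (fromRows A B) h)
  set Y := maxMinor (latRows (fromRows A C) h)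
  have hX : 0 ≤ X := maxMinor_nonneg _
  have hY : 0 ≤ Y := maxMinor_nonneg _
  have k1 : X * Real.exp (θ * rankWeight d (Fintype.card ι)) ≤ Real.exp (-β + θ / 2) :=
    (mul_le_mul_of_nonneg_right m1 (Real.exp_nonneg _)).trans h1
  have k2 : Y * Real.exp (θ * rankWeight d (Fintype.card κ)) ≤ Real.exp (-β + θ / 2) :=
    (mul_le_mul_of_nonneg_right m2 (Real.exp_nonneg _)).trans h2
  have k3 := mul_le_mul g1 g2 (Real.exp_nonneg _) (mul_nonneg (maxMinor_nonneg _)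
    (Real.exp_nonneg _))
  have k4 := mul_le_mul k1 k2 (mul_nonneg hY (Real.exp_nonneg _)) (Real.exp_nonneg _)
  rw [← Real.exp_add] at k3 k4
  have k5 : Real.exp (-β + -β) ≤ (d.factorial * (X * Y)) *
      Real.exp (θ * (rankWeight d (Fintype.card ι) + rankWeight d (Fintype.card κ)) -
        2 * θ * (b * c)) := by
    calc _ ≤ _ := k3
      _ = (maxMinor (latRows A h) * maxMinor (latRows (fromRows (fromRows A B) C) h)) *
          Real.exp (θ * (rankWeight d (Fintype.card (Fin a)) +
            rankWeight d (Fintype.card ((Fin a ⊕ Fin b) ⊕ Fin c)))) := by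
          rw [mul_add, Real.exp_add]; ring
      _ ≤ (d.factorial * (X * Y)) * Real.exp (θ * (rankWeight d (Fintype.card (Fin a)) +
            rankWeight d (Fintype.card ((Fin a ⊕ Fin b) ⊕ Fin c)))) := by
          refine mul_le_mul_of_nonneg_right (hsub.trans ?_) (Real.exp_nonneg _)
          exact mul_le_mul_of_nonneg_right hfac (mul_nonneg hX hY)
      _ = _ := by
          rw [hw]
          congr 2
          ring
  have k6 : Real.exp (-β + -β) ≤ d.factorial * Real.exp (-β + -β - θ) := by
    calc _ ≤ _ := k5
      _ = d.factorial * ((X * Real.exp (θ * rankWeight d (Fintype.card ι))) *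
          (Y * Real.exp (θ * rankWeight d (Fintype.card κ)))) * Real.exp (-(2 * θ * (b * c))) := by
          rw [sub_eq_add_neg, Real.exp_add, mul_add, Real.exp_add]; ring
      _ ≤ d.factorial * Real.exp (-β + θ / 2 + (-β + θ / 2)) * Real.exp (-(2 * θ * 1)) := by
          gcongr
      _ = _ := by
          rw [mul_assoc, ← Real.exp_add]
          congr 2
          ring
  have k7 : Real.exp θ ≤ d.factorial := by
    have : Real.exp (-β + -β) = Real.exp θ * Real.exp (-β + -β - θ) := by
      rw [← Real.exp_add]; congr 1; ring
    rw [this] at k6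
    exact le_of_mul_le_mul_right k6 (Real.exp_pos _)
  exact absurd hθ (not_lt.2 k7)

/-- The deficiency of the weighted covolumes can be reduced by a bounded diagonal translation. -/
theorem exists_weightedCovolGE_step (hd : 2 ≤ d) :
    ∃ θ T : ℝ, 0 < θ ∧ 0 < T ∧ ∀ (h : G d) (β : ℝ), 0 ≤ β → WeightedCovolGE θ (β + 1) h →
      ∃ Z : cartan d, (∀ i, |Z.1 i| ≤ T) ∧ WeightedCovolGE θ β (h * expA Z) := by
  have : Nonempty (Fin d) := ⟨⟨0, by omega⟩⟩
  set c := pivotConst d d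
  have hc : 1 ≤ c := one_le_pivotConst (by omega) d
  set P : ℝ := d.factorial * c ^ d
  have hfac1 : (1 : ℝ) ≤ d.factorial := by
    exact_mod_cast Nat.one_le_iff_ne_zero.2 (Nat.factorial_ne_zero d)
  have hP : 1 ≤ P := one_le_mul_of_one_le_of_one_le hfac1 (one_le_pow₀ hc)
  -- The step length is chosen so that exp(s/2) beats the pivot constant `P` by a factor e.
  set s : ℝ := 2 * (1 + Real.log P)
  have hlog : 0 ≤ Real.log P := Real.log_nonneg hP
  have hs : 0 < s := by positivity
  have hsP : Real.exp (s / 2) = Real.exp 1 * P := by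
    have : s / 2 = 1 + Real.log P := by simp [s]
    rw [this, Real.exp_add, Real.exp_log (by linarith)]
  -- The half θ/2 covers the required gain 1 and the worst loss d·s(d + 1) of a covolume under the
  -- translation; the logarithm gives d! < exp θ, needed for the chain property.
  set θ : ℝ := 2 * (1 + d * (s * (d + 1))) + Real.log d.factorial
  have hlf : 0 ≤ Real.log d.factorial := Real.log_nonneg hfac1
  have hθ : 0 < θ := by positivity
  have hθf : (d.factorial : ℝ) < Real.exp θ := by
    rw [← Real.log_lt_iff_lt_exp (by linarith)]
    simp only [θ]
    have : 0 < 2 * (1 + d * (s * (d + 1))) := by positivity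
    linarith
  refine ⟨θ, s * (d + 1), hθ, by positivity, fun h β hβ hh => ?_⟩
  let 𝓔 : Set (Submodule ℝ (Fin d → ℝ)) := {E | ∃ (ι : Type) (_ : Fintype ι) (_ : DecidableEq ι)
    (V : Matrix ι (Fin d) ℤ), LinearIndependent ℤ V.row ∧
      maxMinor (latRows V h) * Real.exp (θ * rankWeight d (Fintype.card ι)) ≤
        Real.exp (-(β + 1) + θ / 2) ∧ E = latSpan V h}
  have hchain : IsChain (· ≤ ·) 𝓔 := by
    rintro _ ⟨ι, _, _, V, hV, h1, rfl⟩ _ ⟨κ, _, _, V', hV', h2, rfl⟩ -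
    exact latSpan_le_or_le hθf (by omega) hh hV hV' h1 h2
  obtain ⟨J, hJ, hpiv⟩ := exists_isPivot_of_isChain hchain
  obtain ⟨Z, hZ, hZJ⟩ := exists_direction hd hJ
  have hsZ : ∀ i, |(s • Z).1 i| ≤ s * (d + 1) := fun i => by
    change |s * Z.1 i| ≤ _
    rw [abs_mul, abs_of_pos hs]
    exact mul_le_mul_of_nonneg_left (hZ i) hs.le
  refine ⟨s • Z, hsZ, ?_⟩
  intro ι _ _ V hV
  have hk := card_le_of_linearIndependent hV
  rcases Nat.eq_zero_or_pos (Fintype.card ι) with h0 | h0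
  -- Ranks 0 and d have weight 0 and covolume at least 1, so they need only `0 ≤ β`; the direction
  -- need not expand them.
  · have := Fintype.card_eq_zero_iff.1 h0
    rw [maxMinor_of_isEmpty, h0]
    simpa [rankWeight] using hβ
  rcases hk.eq_or_lt with hkd | hkd
  · rw [hkd]
    have := one_le_maxMinor_latRows hV hkd (h * expA (s • Z))
    simp only [rankWeight, sub_self, mul_zero, Real.exp_zero, mul_one]
    exact le_trans (Real.exp_le_one_iff.2 (by linarith)) this
  rw [latRows_mul_expA]
  set q := Real.exp (θ * rankWeight d (Fintype.card ι))
  have hq : 0 < q := Real.exp_pos _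
  -- A nearly minimal sublattice belongs to the chain and gains the factor e; any other one has
  -- enough room to absorb the loss.
  by_cases hnear : maxMinor (latRows V h) * q ≤ Real.exp (-(β + 1) + θ / 2)
  · have hE : latSpan V h ∈ 𝓔 := ⟨ι, _, _, V, hV, hnear, rfl⟩
    have hp := hpiv _ hE
    have hj : (J (Module.finrank ℝ (latSpan V h))).card = Fintype.card ι := by
      rw [hp.1, finrank_latSpan hV]
    have h1 := hp.exp_mul_maxMinor_le (linearIndependent_latRows hV h) rfl
      (fun i => (s • Z).1 i)
    have h2 := hZJ (Module.finrank ℝ (latSpan V h)) (by rw [finrank_latSpan hV]; exact hk)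
      (by rw [hj]; exact h0) (by rw [hj]; exact hkd)
    have h3 : s / 2 ≤ ∑ i ∈ J (Module.finrank ℝ (latSpan V h)), (s • Z).1 i := by
      have : ∑ i ∈ J (Module.finrank ℝ (latSpan V h)), (s • Z).1 i =
          s * ∑ i ∈ J (Module.finrank ℝ (latSpan V h)), Z.1 i := by
        rw [Finset.mul_sum]; rfl
      rw [this]
      nlinarith
    have h4 : ((Fintype.card ι).factorial : ℝ) * pivotConst (Fintype.card (Fin d))
        (Fintype.card (Fin d)) ^ Fintype.card ι ≤ P := by
      rw [Fintype.card_fin]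
      have hf : ((Fintype.card ι).factorial : ℝ) ≤ d.factorial := by
        exact_mod_cast Nat.factorial_le hk
      exact mul_le_mul hf (pow_le_pow_right₀ hc hk) (by positivity) (by positivity)
    set X := maxMinor (latRows V h * Matrix.diagonal fun i => Real.exp ((s • Z).1 i))
    have hX : 0 ≤ X := maxMinor_nonneg _
    have h5 : Real.exp 1 * P * maxMinor (latRows V h) ≤ P * X := by
      rw [← hsP]
      exact (mul_le_mul_of_nonneg_right (Real.exp_le_exp.2 h3) (maxMinor_nonneg _)).trans
        (h1.trans (mul_le_mul_of_nonneg_right h4 hX))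
    have h6 : Real.exp 1 * maxMinor (latRows V h) ≤ X := by
      refine le_of_mul_le_mul_left (le_trans (le_of_eq ?_) h5) (by linarith : 0 < P)
      ring
    calc Real.exp (-β) = Real.exp 1 * Real.exp (-(β + 1)) := by
          rw [← Real.exp_add]; congr 1; ring
      _ ≤ Real.exp 1 * (maxMinor (latRows V h) * q) :=
          mul_le_mul_of_nonneg_left (hh ι V hV) (Real.exp_nonneg _)
      _ = Real.exp 1 * maxMinor (latRows V h) * q := by ring
      _ ≤ X * q := mul_le_mul_of_nonneg_right h6 hq.le
  · have h1 := exp_mul_maxMinor_le (latRows V h) hsZ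
    push Not at hnear
    have h2 : Real.exp (-(d * (s * (d + 1)))) ≤
        Real.exp (-(Fintype.card ι * (s * (d + 1)))) := by
      rw [Real.exp_le_exp, neg_le_neg_iff]
      have : (Fintype.card ι : ℝ) ≤ d := by exact_mod_cast hk
      exact mul_le_mul_of_nonneg_right this (by positivity)
    calc Real.exp (-β) ≤ Real.exp (-(d * (s * (d + 1)))) * Real.exp (-(β + 1) + θ / 2) := by
          rw [← Real.exp_add, Real.exp_le_exp]
          simp only [θ]
          linarith
      _ ≤ Real.exp (-(Fintype.card ι * (s * (d + 1)))) * (maxMinor (latRows V h) * q) :=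
          mul_le_mul h2 hnear.le (Real.exp_nonneg _) (Real.exp_nonneg _)
      _ = Real.exp (-(Fintype.card ι * (s * (d + 1)))) * maxMinor (latRows V h) * q := by ring
      _ ≤ _ := mul_le_mul_of_nonneg_right h1 hq.le

theorem WeightedCovolGE.mono {θ β β' : ℝ} {h : G d} (hh : WeightedCovolGE θ β h) (hβ : β ≤ β') :
    WeightedCovolGE θ β' h := fun ι _ _ V hV =>
  (Real.exp_le_exp.2 (neg_le_neg hβ)).trans (hh ι V hV)

theorem exists_weightedCovolGE_zero (hd : 2 ≤ d) :
    ∃ θ T : ℝ, 0 < θ ∧ 0 < T ∧ ∀ (h : G d) (β : ℝ), 0 ≤ β → WeightedCovolGE θ β h →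
      ∃ Z : cartan d, (∀ i, |Z.1 i| ≤ T * (β + 1)) ∧ WeightedCovolGE θ 0 (h * expA Z) := by
  obtain ⟨θ, T, hθ, hT, hstep⟩ := exists_weightedCovolGE_step hd
  have key : ∀ (m : ℕ) (h : G d), WeightedCovolGE θ m h →
      ∃ Z : cartan d, (∀ i, |Z.1 i| ≤ T * m) ∧ WeightedCovolGE θ 0 (h * expA Z) := by
    intro m
    induction m with
    | zero =>
      intro h hh
      refine ⟨0, fun i => by simp, ?_⟩
      rw [expA_zero, mul_one]
      simpa using hh
    | succ m ih =>
      intro h hh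
      obtain ⟨Z, hZ, h1⟩ := hstep h m (Nat.cast_nonneg m) (by exact_mod_cast hh)
      obtain ⟨Z', hZ', h2⟩ := ih _ h1
      refine ⟨Z + Z', fun i => ?_, ?_⟩
      · calc |(Z + Z').1 i| = |Z.1 i + Z'.1 i| := rfl
          _ ≤ |Z.1 i| + |Z'.1 i| := abs_add_le _ _
          _ ≤ T + T * m := add_le_add (hZ i) (hZ' i)
          _ = T * (m + 1 : ℕ) := by push_cast; ring
      · rwa [expA_add, ← mul_assoc]
  refine ⟨θ, T, hθ, hT, fun h β hβ hh => ?_⟩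
  obtain ⟨Z, hZ, h1⟩ := key ⌈β⌉₊ h (hh.mono (Nat.le_ceil β))
  exact ⟨Z, fun i => (hZ i).trans
    (mul_le_mul_of_nonneg_left (Nat.ceil_lt_add_one hβ).le hT.le), h1⟩

end FlatTori

namespace FlatTori

/-! ### Lower bounds for covolumes and for the systole -/

variable {d : ℕ}

theorem linearIndependent_of_latRows {ι : Type*} [Fintype ι] [DecidableEq ι]
    {X : Matrix ι (Fin d) ℤ} {h : G d} (hX : LinearIndependent ℝ (latRows X h).row) :
    LinearIndependent ℤ X.row := by
  rw [← Matrix.vecMul_injective_iff] at hX ⊢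
  intro x y hxy
  have hcast : ∀ z : ι → ℤ, (fun i => (z i : ℝ)) ᵥ* latRows X h =
      (fun j => (((z ᵥ* X) j : ℤ) : ℝ)) ᵥ* mat h := by
    intro z
    rw [latRows, ← Matrix.vecMul_vecMul]
    congr 1
    ext j
    simp [Matrix.vecMul, dotProduct]
  have h1 : (fun i => (x i : ℝ)) = fun i => (y i : ℝ) := hX (by
    simp only [hcast]
    rw [show x ᵥ* X = y ᵥ* X from hxy])
  ext i
  exact_mod_cast congrFun h1 i

theorem intCast_vecMul {ι : Type*} [Fintype ι] (v : ι → ℤ) (X : Matrix ι (Fin d) ℤ) :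
    (fun j => (((v ᵥ* X) j : ℤ) : ℝ)) = (fun i => (v i : ℝ)) ᵥ* X.map (Int.cast : ℤ → ℝ) := by
  ext j
  simp [Matrix.vecMul, dotProduct]

/-- Independent vectors can be completed to a maximal independent family by rows of an invertible
matrix. -/
theorem exists_completion {ι : Type} [Fintype ι] [DecidableEq ι] {W : Matrix ι (Fin d) ℝ}
    (hW : LinearIndependent ℝ W.row) {Q : Matrix (Fin d) (Fin d) ℝ}
    (hQ : LinearIndependent ℝ Q.row) :
    ∃ (κ : Type) (_ : Fintype κ) (_ : DecidableEq κ) (f : κ → Fin d),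
      LinearIndependent ℝ (fromRows W (Q.submatrix f id)).row ∧ Fintype.card (ι ⊕ κ) = d := by
  classical
  let v : ι ⊕ Fin d → (Fin d → ℝ) := Sum.elim W Q
  have hs : LinearIndepOn ℝ v (Set.range Sum.inl) :=
    (linearIndepOn_range_iff Sum.inl_injective v).2 hW
  obtain ⟨b, -, hsb, htb, hb⟩ := exists_linearIndepOn_extension hs (Set.subset_univ _)
  let κ : Type := {i : Fin d // Sum.inr i ∈ b}
  let f : ι ⊕ κ → b := Sum.elim (fun i => ⟨Sum.inl i, hsb ⟨i, rfl⟩⟩) fun i => ⟨Sum.inr i.1, i.2⟩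
  have hf : Function.Bijective f := by
    constructor
    · rintro (i | i) (j | j) hij
      · simpa [f] using hij
      · simp [f] at hij
      · simp [f] at hij
      · have := congrArg Subtype.val hij
        simp only [f, Sum.elim_inr, Sum.inr.injEq] at this
        exact congrArg Sum.inr (Subtype.ext this)
    · rintro ⟨i | i, hi⟩
      · exact ⟨Sum.inl i, rfl⟩
      · exact ⟨Sum.inr ⟨i, hi⟩, rfl⟩
  have hrow : (fromRows W (Q.submatrix (Subtype.val : κ → Fin d) id)).row =
      (fun x : b => v x) ∘ f := by
    ext (i | i) j <;> rfl
  have hli : LinearIndependent ℝ (fromRows W (Q.submatrix (Subtype.val : κ → Fin d) id)).row := by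
    rw [hrow]
    exact hb.comp f hf.1
  refine ⟨κ, inferInstance, inferInstance, Subtype.val, hli, ?_⟩
  have htop : Submodule.span ℝ
      (Set.range (fromRows W (Q.submatrix (Subtype.val : κ → Fin d) id)).row) = ⊤ := by
    have h1 : Submodule.span ℝ (Set.range Q.row) = ⊤ :=
      hQ.span_eq_top_of_card_eq_finrank' (by simp)
    rw [hrow, hf.2.range_comp, eq_top_iff, ← h1, Submodule.span_le]
    rintro _ ⟨i, rfl⟩
    have := htb ⟨Sum.inr i, Set.mem_univ _, rfl⟩
    rw [Set.image_eq_range] at this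
    exact this
  rw [← finrank_span_eq_card hli, htop, finrank_top, Module.finrank_pi, Fintype.card_fin]

/-- A lattice with a short vector without zero coordinates, which is invariant under a diagonal
matrix with distinct entries of bounded size, has no sublattices of very small covolume. -/
theorem weightedCovolGE_of_diagonal (hd : 0 < d) {θ : ℝ} (hθ : 0 ≤ θ) {h : G d}
    {T : Matrix (Fin d) (Fin d) ℤ} {D : Fin d → ℝ}
    (hT : T.map (Int.cast : ℤ → ℝ) * mat h = mat h * Matrix.diagonal D)
    (hD : Function.Injective D) {t : ℝ} (ht : 0 ≤ t) (hDt : ∀ i, |D i| ≤ Real.exp t)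
    {v : Fin d → ℤ} (hv0 : ∀ i, ((fun i => (v i : ℝ)) ᵥ* mat h) i ≠ 0)
    (hv1 : ∀ i, |((fun i => (v i : ℝ)) ᵥ* mat h) i| ≤ 1) :
    WeightedCovolGE θ (Real.log d.factorial + d * (d * t)) h := by
  have : Nonempty (Fin d) := ⟨⟨0, hd⟩⟩
  set u := (fun i => (v i : ℝ)) ᵥ* mat h with hu
  -- The images of the short vector under powers of `T`. In the coordinates of the lattice they form
  -- a Vandermonde matrix with columns scaled by the nonzero coordinates of `u`.
  let M₀ : Matrix (Fin d) (Fin d) ℤ := Matrix.of fun i => v ᵥ* T ^ (i : ℕ)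
  have hpow : ∀ k : ℕ, (T ^ k).map (Int.cast : ℤ → ℝ) * mat h =
      mat h * Matrix.diagonal fun i => D i ^ k := by
    intro k
    induction k with
    | zero => simp [Matrix.map_one]
    | succ k ih =>
      have h1 : (T ^ (k + 1)).map (Int.cast : ℤ → ℝ) =
          (T ^ k).map (Int.cast : ℤ → ℝ) * T.map (Int.cast : ℤ → ℝ) := by
        rw [pow_succ]
        exact Matrix.map_mul (f := Int.castRingHom ℝ)
      rw [h1, Matrix.mul_assoc, hT, ← Matrix.mul_assoc, ih, Matrix.mul_assoc,
        Matrix.diagonal_mul_diagonal]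
      simp only [pow_succ]
  have hrow : ∀ i j, latRows M₀ h i j = u j * D j ^ (i : ℕ) := by
    intro i j
    have h1 : latRows M₀ h i = (fun j => (((v ᵥ* T ^ (i : ℕ)) j : ℤ) : ℝ)) ᵥ* mat h := rfl
    rw [h1, intCast_vecMul, Matrix.vecMul_vecMul, hpow, ← Matrix.vecMul_vecMul, ← hu,
      Matrix.vecMul_diagonal]
  have hQ : LinearIndependent ℝ (latRows M₀ h).row := by
    refine Matrix.linearIndependent_rows_of_det_ne_zero (A := latRows M₀ h) ?_
    have h1 : latRows M₀ h = (Matrix.vandermonde D)ᵀ * Matrix.diagonal u := by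
      ext i j
      rw [hrow, Matrix.mul_diagonal, Matrix.transpose_apply, Matrix.vandermonde_apply, mul_comm]
    rw [h1, Matrix.det_mul, Matrix.det_transpose, Matrix.det_diagonal]
    exact mul_ne_zero (Matrix.det_vandermonde_ne_zero_iff.2 hD)
      (Finset.prod_ne_zero_iff.2 fun i _ => hv0 i)
  intro ι _ _ V hV
  have hk := card_le_of_linearIndependent hV
  have hW := linearIndependent_latRows hV h
  obtain ⟨κ, _, _, f, hli, hcard⟩ := exists_completion hW hQ
  have heq : fromRows (latRows V h) ((latRows M₀ h).submatrix f id) =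
      latRows (fromRows V (M₀.submatrix f id)) h := by
    rw [latRows_fromRows]; rfl
  -- The completed family has full rank, so its determinant is at least 1, while the added rows have
  -- entries at most exp(dt). The covolume of `V` cannot then be too small.
  have h1 : 1 ≤ maxMinor (fromRows (latRows V h) ((latRows M₀ h).submatrix f id)) := by
    rw [heq]
    refine one_le_maxMinor_latRows (linearIndependent_of_latRows (h := h) ?_) hcard h
    rw [← heq]
    exact hli
  have h2 := maxMinor_fromRows_le (W := latRows V h) (U := (latRows M₀ h).submatrix f id)
    (c := Real.exp (d * t)) (Real.one_le_exp (by positivity)) (fun i j => by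
      rw [Matrix.submatrix_apply, hrow, abs_mul, abs_pow]
      calc |u j| * |D j| ^ (f i : ℕ) ≤ 1 * Real.exp t ^ (f i : ℕ) :=
            mul_le_mul (hv1 _) (pow_le_pow_left₀ (abs_nonneg _) (hDt _) _) (by positivity)
              zero_le_one
        _ ≤ Real.exp t ^ d := by
            rw [one_mul]
            exact pow_le_pow_right₀ (Real.one_le_exp ht) (f i).2.le
        _ = _ := by rw [← Real.exp_nat_mul]) hW
  rw [hcard] at h2
  have h3 : ((d.factorial : ℝ) * Real.exp (d * t) ^ d) =
      Real.exp (Real.log d.factorial + d * (d * t)) := by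
    rw [Real.exp_add, Real.exp_log (by exact_mod_cast Nat.factorial_pos d), ← Real.exp_nat_mul]
  rw [h3] at h2
  have h4 : 0 ≤ rankWeight d (Fintype.card ι) := by
    have : (Fintype.card ι : ℝ) ≤ d := by exact_mod_cast hk
    exact mul_nonneg (Nat.cast_nonneg _) (sub_nonneg.2 this)
  have h5 : Real.exp (-(Real.log d.factorial + d * (d * t))) ≤ maxMinor (latRows V h) := by
    rw [Real.exp_neg, inv_le_iff_one_le_mul₀ (Real.exp_pos _)]
    exact h1.trans h2
  exact h5.trans (le_mul_of_one_le_right (maxMinor_nonneg _)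
    (Real.one_le_exp (mul_nonneg hθ h4)))

theorem norm_toLp_le_mul {x y : Fin d → ℝ} {c : ℝ} (hc : 0 ≤ c) (h : ∀ i, |x i| ≤ c * |y i|) :
    ‖WithLp.toLp 2 x‖ ≤ c * ‖WithLp.toLp 2 y‖ := by
  rw [EuclideanSpace.norm_eq, EuclideanSpace.norm_eq, ← Real.sqrt_sq hc,
    ← Real.sqrt_mul (sq_nonneg c), Finset.mul_sum]
  refine Real.sqrt_le_sqrt (Finset.sum_le_sum fun i _ => ?_)
  rw [← mul_pow]
  exact pow_le_pow_left₀ (norm_nonneg _) (h i) 2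

theorem abs_apply_le_norm_toLp (x : Fin d → ℝ) (i : Fin d) : |x i| ≤ ‖WithLp.toLp 2 x‖ :=
  PiLp.norm_apply_le (WithLp.toLp 2 x) i

theorem abs_apply_le_norm (Y : cartan d) (i : Fin d) : |Y.1 i| ≤ ‖Y‖ := PiLp.norm_apply_le Y.1 i

theorem systoleG_le (h : G d) {v : Fin d → ℤ} (hv : v ≠ 0) :
    systoleG h ≤ ‖WithLp.toLp 2 ((fun i => (v i : ℝ)) ᵥ* mat h)‖ :=
  csInf_le ⟨0, by rintro _ ⟨w, -, rfl⟩; exact norm_nonneg _⟩ ⟨v, hv, rfl⟩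

theorem le_systoleG (hd : 0 < d) {h : G d} {c : ℝ}
    (hc : ∀ v : Fin d → ℤ, v ≠ 0 → c ≤ ‖WithLp.toLp 2 ((fun i => (v i : ℝ)) ᵥ* mat h)‖) :
    c ≤ systoleG h := by
  have : Nonempty (Fin d) := ⟨⟨0, hd⟩⟩
  refine le_csInf ⟨_, 1, one_ne_zero, rfl⟩ ?_
  rintro _ ⟨v, hv, rfl⟩
  exact hc v hv

theorem exists_norm_lt_of_systoleG_lt (hd : 0 < d) {h : G d} {c : ℝ} (hc : systoleG h < c) :
    ∃ v : Fin d → ℤ, v ≠ 0 ∧ ‖WithLp.toLp 2 ((fun i => (v i : ℝ)) ᵥ* mat h)‖ < c := by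
  by_contra! hn
  exact absurd hc (not_lt.2 (le_systoleG hd hn))

/-- A nonzero integer vector has a coordinate of size at least 1, and it is recovered from its image
by the fixed matrix `h⁻¹`. -/
theorem systoleG_pos (hd : 0 < d) (h : G d) : 0 < systoleG h := by
  have : Nonempty (Fin d) := ⟨⟨0, hd⟩⟩
  set B : ℝ := 1 + ∑ i, ∑ j, |mat h⁻¹ j i| with hB
  have hB0 : 0 < B := by positivity
  refine lt_of_lt_of_le (inv_pos.2 hB0) (le_systoleG hd fun v hv => ?_)
  obtain ⟨i, hi⟩ := Function.ne_iff.1 hv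
  set u := (fun i => (v i : ℝ)) ᵥ* mat h with hu
  have h1 : (fun i => (v i : ℝ)) = u ᵥ* mat h⁻¹ := by
    rw [hu, Matrix.vecMul_vecMul, mat_mul_inv, Matrix.vecMul_one]
  rw [inv_le_iff_one_le_mul₀ hB0]
  have h2 : (1 : ℝ) ≤ |(v i : ℝ)| := by exact_mod_cast Int.one_le_abs hi
  calc (1 : ℝ) ≤ |(u ᵥ* mat h⁻¹) i| := by rw [← h1]; exact h2
    _ = |∑ j, u j * mat h⁻¹ j i| := rfl
    _ ≤ ∑ j, |u j * mat h⁻¹ j i| := Finset.abs_sum_le_sum_abs _ _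
    _ ≤ ∑ j, ‖WithLp.toLp 2 u‖ * |mat h⁻¹ j i| := Finset.sum_le_sum fun j _ => by
        rw [abs_mul]
        exact mul_le_mul_of_nonneg_right (abs_apply_le_norm_toLp u j) (abs_nonneg _)
    _ = ‖WithLp.toLp 2 u‖ * ∑ j, |mat h⁻¹ j i| := by rw [Finset.mul_sum]
    _ ≤ ‖WithLp.toLp 2 u‖ * B := by
        refine mul_le_mul_of_nonneg_left ?_ (norm_nonneg _)
        have := Finset.single_le_sum (f := fun i => ∑ j, |mat h⁻¹ j i|)
          (fun i _ => Finset.sum_nonneg fun j _ => abs_nonneg _) (Finset.mem_univ i)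
        linarith

theorem vecMul_mul_expA (w : Fin d → ℝ) (h : G d) (Y : cartan d) (i : Fin d) :
    (w ᵥ* mat (h * expA Y)) i = (w ᵥ* mat h) i * Real.exp (Y.1 i) := by
  rw [mat_mul, ← Matrix.vecMul_vecMul]
  exact Matrix.vecMul_diagonal _ _ _

theorem exp_mul_systoleG_le (hd : 0 < d) (h : G d) (Y : cartan d) :
    Real.exp (-‖Y‖) * systoleG h ≤ systoleG (h * expA Y) := by
  refine le_systoleG hd fun v hv => ?_
  rw [Real.exp_neg, inv_mul_le_iff₀ (Real.exp_pos _)]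
  refine (systoleG_le h hv).trans (norm_toLp_le_mul (Real.exp_nonneg _) fun i => ?_)
  rw [vecMul_mul_expA, abs_mul, Real.abs_exp, mul_left_comm, ← Real.exp_add]
  refine le_mul_of_one_le_right (abs_nonneg _) (Real.one_le_exp ?_)
  have := (abs_le.1 (abs_apply_le_norm Y i)).1
  linarith

theorem WeightedCovolGE.exp_le_systoleG (hd : 0 < d) {θ : ℝ} {h : G d}
    (hh : WeightedCovolGE θ 0 h) : Real.exp (-(θ * (d - 1))) ≤ systoleG h := by
  have : Nonempty (Fin d) := ⟨⟨0, hd⟩⟩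
  refine le_systoleG hd fun v hv => ?_
  let V : Matrix Unit (Fin d) ℤ := Matrix.of fun _ => v
  have hV : LinearIndependent ℤ V.row := by
    rw [linearIndependent_unique_iff]
    exact hv
  have h1 := hh Unit V hV
  have h2 : maxMinor (latRows V h) ≤ ‖WithLp.toLp 2 ((fun i => (v i : ℝ)) ᵥ* mat h)‖ := by
    refine maxMinor_le fun I => ?_
    rw [Matrix.det_unique]
    exact abs_apply_le_norm_toLp ((fun i => (v i : ℝ)) ᵥ* mat h) (I default)
  rw [neg_zero, Real.exp_zero] at h1
  have h3 : rankWeight d (Fintype.card Unit) = d - 1 := by simp [rankWeight]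
  rw [h3] at h1
  rw [Real.exp_neg, inv_le_iff_one_le_mul₀ (Real.exp_pos _)]
  exact h1.trans (mul_le_mul_of_nonneg_right h2 (Real.exp_nonneg _))

end FlatTori

/-! ### Averaging over a fundamental domain -/

namespace FlatTori

open Pointwise in
/-- If near each point of `A` the invariant set `S` contains a ball of a size comparable to the
distance, then `A` is not much larger than `S` modulo the lattice. -/
theorem measure_inter_fundamentalDomain_le {E : Type*} [NormedAddCommGroup E] [NormedSpace ℝ E]
    [FiniteDimensional ℝ E] [MeasurableSpace E] [BorelSpace E] (μ : Measure E)
    [μ.IsAddHaarMeasure] {L : Submodule ℤ E} [Countable L] {D A S : Set E}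
    (hD : IsAddFundamentalDomain L D μ) (hA : MeasurableSet A) (hS : MeasurableSet S)
    (hSL : ∀ l : L, ∀ x, (l : E) + x ∈ S ↔ x ∈ S) {ρ k : ℝ} (hρ : 0 < ρ) (hk : 0 < k)
    (hball : ∀ y ∈ A, ∃ x, Metric.ball x ρ ⊆ S ∩ Metric.ball y (k * ρ)) :
    μ (D ∩ A) ≤ ENNReal.ofReal (k ^ Module.finrank ℝ E) * μ (D ∩ S) := by
  set b := μ (Metric.ball (0 : E) ρ) with hb
  have hb0 : b ≠ 0 := (Metric.measure_ball_pos μ 0 hρ).ne'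
  have hbtop : b ≠ ⊤ := measure_ball_lt_top.ne
  have hmeas : Measurable (Function.uncurry fun (y z : E) =>
      S.indicator (1 : E → ENNReal) (y + z)) :=
    (measurable_one.indicator hS).comp (measurable_fst.add measurable_snd)
  -- Double counting of the pairs (y, z) with y in `D`, z in the ball of radius kρ and y + z in `S`:
  -- each y in `A` sees a whole ball of radius ρ in `S`.
  have h1 : b * μ (D ∩ A) ≤
      ∫⁻ y in D, ∫⁻ z in Metric.ball 0 (k * ρ), S.indicator (1 : E → ENNReal) (y + z) ∂μ ∂μ := by
    calc b * μ (D ∩ A) = ∫⁻ y in D, A.indicator (fun _ => b) y ∂μ := by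
          rw [lintegral_indicator_const hA, Measure.restrict_apply hA, Set.inter_comm]
      _ ≤ _ := by
          refine lintegral_mono fun y => ?_
          by_cases hy : y ∈ A
          · rw [Set.indicator_of_mem hy]
            obtain ⟨x, hx⟩ := hball y hy
            have h2 : ∀ z, S.indicator (1 : E → ENNReal) (y + z) =
                ((fun z => y + z) ⁻¹' S).indicator 1 z := fun z => rfl
            have hS' : MeasurableSet ((fun z => y + z) ⁻¹' S) := (measurable_const_add y) hS
            simp only [h2]
            rw [lintegral_indicator_one hS', Measure.restrict_apply hS', hb,
              ← Measure.addHaar_ball_center μ (x - y)]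
            refine measure_mono fun z hz => ?_
            have hz' : y + z ∈ Metric.ball x ρ := by
              rw [Metric.mem_ball, dist_eq_norm] at hz ⊢
              rwa [show y + z - x = z - (x - y) by abel]
            refine ⟨(hx hz').1, ?_⟩
            have := (hx hz').2
            rw [Metric.mem_ball, dist_eq_norm, add_sub_cancel_left] at this
            simpa using this
          · rw [Set.indicator_of_notMem hy]
            exact zero_le
  -- The translate of `D` by z is again a fundamental domain, and `S` is periodic.
  have h3 : ∀ z, ∫⁻ y in D, S.indicator (1 : E → ENNReal) (y + z) ∂μ = μ (D ∩ S) := by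
    intro z
    have h2 : ∀ y, S.indicator (1 : E → ENNReal) (y + z) =
        ((fun y => y + z) ⁻¹' S).indicator 1 y := fun z => rfl
    have hS' : MeasurableSet ((fun y => y + z) ⁻¹' S) := (measurable_add_const z) hS
    simp only [h2]
    rw [lintegral_indicator_one hS', Measure.restrict_apply hS']
    have h4 : z +ᵥ ((fun y => y + z) ⁻¹' S ∩ D) = S ∩ (z +ᵥ D) := by
      rw [Set.vadd_set_inter]
      congr 1
      ext y
      rw [Set.mem_vadd_set_iff_neg_vadd_mem]
      simp
    have : VAddInvariantMeasure L E μ := ⟨fun l s _ => measure_preimage_add μ (l : E) s⟩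
    rw [← measure_vadd μ z, h4, Set.inter_comm D S]
    refine (hD.vadd_of_comm z).measure_set_eq hD hS fun l => ?_
    ext x
    exact hSL l x
  rw [lintegral_lintegral_swap hmeas.aemeasurable] at h1
  simp only [h3, lintegral_const, Measure.restrict_apply MeasurableSet.univ, Set.univ_inter] at h1
  rw [Measure.addHaar_ball_mul_of_pos μ 0 hk ρ, ← hb] at h1
  rw [← ENNReal.mul_le_mul_iff_right hb0 hbtop]
  refine h1.trans (le_of_eq ?_)
  ring

/-! ### Compact periodic orbits and the systole along them -/

variable {d : ℕ}

instance : (leb d).IsAddHaarMeasure := by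
  unfold leb
  infer_instance

theorem mat_incl (γ : Matrix.SpecialLinearGroup (Fin d) ℤ) :
    mat (incl d γ) = (mat γ).map (Int.cast : ℤ → ℝ) := rfl

/-- The elements of `M` are diagonal matrices of signs. -/
theorem exists_mat_eq_diagonal {m : G d} (hm : m ∈ M d) {Y : cartan d}
    (hY : Function.Injective fun i => Y.1 i) :
    ∃ ε : Fin d → ℝ, mat m = Matrix.diagonal ε ∧ ∀ i, |ε i| = 1 := by
  have hK : mat m * (mat m)ᵀ = 1 := (Subgroup.mem_inf.1 hm).1
  have hc : expA Y * m = m * expA Y :=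
    (Subgroup.mem_centralizer_iff.1 (Subgroup.mem_inf.1 hm).2) _ ⟨Y, rfl⟩
  have hc' : Matrix.diagonal (fun i => Real.exp (Y.1 i)) * mat m =
      mat m * Matrix.diagonal fun i => Real.exp (Y.1 i) := by
    have := congrArg mat hc
    rwa [mat_mul, mat_mul] at this
  have hdiag : mat m = Matrix.diagonal fun i => mat m i i := by
    ext i j
    by_cases hij : i = j
    · subst hij; simp
    · rw [Matrix.diagonal_apply_ne _ hij]
      have := congrFun (congrFun hc' i) j
      rw [Matrix.diagonal_mul, Matrix.mul_diagonal, mul_comm] at this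
      have h2 : mat m i j * (Real.exp (Y.1 i) - Real.exp (Y.1 j)) = 0 := by
        rw [mul_sub, this, sub_self]
      refine (mul_eq_zero.1 h2).resolve_right fun h3 => hij (hY ?_)
      exact Real.exp_injective (sub_eq_zero.1 h3)
  refine ⟨fun i => mat m i i, hdiag, fun i => ?_⟩
  rw [hdiag, Matrix.diagonal_transpose, Matrix.diagonal_mul_diagonal] at hK
  have := congrFun (congrFun hK i) i
  rw [Matrix.diagonal_apply_eq, Matrix.one_apply_eq] at this
  have h2 : |mat m i i| * |mat m i i| = 1 := by rw [abs_mul_abs_self]; exact this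
  nlinarith [abs_nonneg (mat m i i)]

/-- Since the coordinates sum to 0, each one is the average of its differences with all of them. -/
theorem abs_le_killingNorm (hd : 0 < d) (Y : cartan d) (i : Fin d) : |Y.1 i| ≤ killingNorm Y := by
  have h1 : ∀ j, |Y.1 i - Y.1 j| ≤ killingNorm Y := by
    intro j
    rw [← Real.sqrt_sq_eq_abs]
    refine Real.sqrt_le_sqrt ?_
    calc (Y.1 i - Y.1 j) ^ 2 ≤ ∑ l, (Y.1 i - Y.1 l) ^ 2 :=
          Finset.single_le_sum (f := fun l => (Y.1 i - Y.1 l) ^ 2) (fun l _ => sq_nonneg _)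
            (Finset.mem_univ j)
      _ ≤ _ := Finset.single_le_sum (f := fun k => ∑ l, (Y.1 k - Y.1 l) ^ 2)
            (fun k _ => Finset.sum_nonneg fun l _ => sq_nonneg _) (Finset.mem_univ i)
  have hsum : ∑ j, Y.1 j = 0 := Y.2
  have h2 : (d : ℝ) * Y.1 i = ∑ j, (Y.1 i - Y.1 j) := by
    rw [Finset.sum_sub_distrib, hsum]
    simp
  have h3 : (d : ℝ) * |Y.1 i| ≤ d * killingNorm Y := by
    calc (d : ℝ) * |Y.1 i| = |(d : ℝ) * Y.1 i| := by rw [abs_mul, Nat.abs_cast]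
      _ ≤ ∑ j, |Y.1 i - Y.1 j| := by rw [h2]; exact Finset.abs_sum_le_sum_abs _ _
      _ ≤ ∑ _j : Fin d, killingNorm Y := Finset.sum_le_sum fun j _ => h1 j
      _ = _ := by simp
  exact le_of_mul_le_mul_left h3 (Nat.cast_pos.2 hd)

theorem norm_le_mul_of_abs_le {Y : cartan d} {B : ℝ} (hB : 0 ≤ B) (hY : ∀ i, |Y.1 i| ≤ B) :
    ‖Y‖ ≤ B * ‖WithLp.toLp 2 (1 : Fin d → ℝ)‖ :=
  norm_toLp_le_mul (x := fun i => Y.1 i) hB fun i => by simpa using hY i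

theorem exists_mem_abs_sub_le {L : Submodule ℤ (cartan d)} [DiscreteTopology L] [IsZLattice ℝ L] :
    ∃ R : ℝ, ∀ x : cartan d, ∃ Y ∈ L, ∀ i, |x.1 i - Y.1 i| ≤ R := by
  have : Module.Finite ℤ L := ZLattice.module_finite ℝ L
  have : Module.Free ℤ L := ZLattice.module_free ℝ L
  let b := (Module.Free.chooseBasis ℤ L).ofZLatticeBasis ℝ L
  refine ⟨∑ i, ‖b i‖, fun x => ⟨ZSpan.floor b x, ?_, fun i => ?_⟩⟩
  · exact (Module.Basis.ofZLatticeBasis_span ℝ L _).le (ZSpan.floor b x).2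
  · exact (abs_apply_le_norm (x - (ZSpan.floor b x : cartan d)) i).trans (ZSpan.norm_fract_le b x)

variable {Γ : Subgroup (Matrix.SpecialLinearGroup (Fin d) ℤ)}

/-- The vectors of a lattice on a compact periodic orbit have no zero coordinates. -/
theorem vecMul_apply_ne_zero (hd : 0 < d) {F : Set (FlatSpace Γ)}
    [DiscreteTopology (periods Γ F)] [IsZLattice ℝ (periods Γ F)] {g : G d} (hg : pt Γ g ∈ F)
    {v : Fin d → ℤ} (hv : v ≠ 0) (i : Fin d) : ((fun i => (v i : ℝ)) ᵥ* mat g) i ≠ 0 := by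
  intro h0
  set u := (fun i => (v i : ℝ)) ᵥ* mat g with hu
  obtain ⟨R, hR⟩ := exists_mem_abs_sub_le (L := periods Γ F)
  have hσ := systoleG_pos hd g
  obtain ⟨N, hN⟩ : ∃ N : ℝ, Real.exp (R - N) * ‖WithLp.toLp 2 u‖ < systoleG g := by
    have : Filter.Tendsto (fun N : ℝ => Real.exp (R - N) * ‖WithLp.toLp 2 u‖) Filter.atTop
        (nhds 0) := by
      have h1 : Filter.Tendsto (fun N : ℝ => R - N) Filter.atTop Filter.atBot :=
        Filter.tendsto_atBot_add_const_left _ _ Filter.tendsto_neg_atTop_atBot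
      simpa using (Real.tendsto_exp_atBot.comp h1).mul_const _
    exact (this.eventually_lt_const hσ).exists
  -- A period near this point contracts all coordinates but the i-th. If the i-th were zero, the
  -- vector would become shorter than the systole, which a period preserves.
  let x : EuclideanSpace ℝ (Fin d) := WithLp.toLp 2 fun k => (if k = i then d * N else 0) - N
  have hx : x ∈ cartan d := by
    change ∑ k, ((if k = i then d * N else 0) - N) = 0
    simp
  obtain ⟨Y, hY, hYx⟩ := hR ⟨x, hx⟩
  have hper : flow Γ Y (pt Γ g) = pt Γ g := hY _ hg
  have hsys : systoleG (g * expA Y) = systoleG g := congrArg (systole Γ) hper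
  have h1 := systoleG_le (g * expA Y) hv
  rw [hsys] at h1
  refine absurd hN (not_lt.2 (h1.trans (norm_toLp_le_mul (Real.exp_nonneg _) fun k => ?_)))
  rw [vecMul_mul_expA, ← hu]
  by_cases hk : k = i
  · rw [hk, h0, zero_mul]; simp
  · rw [abs_mul, Real.abs_exp, mul_comm]
    refine mul_le_mul_of_nonneg_right (Real.exp_le_exp.2 ?_) (abs_nonneg _)
    have h2 := (abs_le.1 (hYx k)).1
    have h3 : x k = -N := by simp [x, hk]
    change -R ≤ x k - Y.1 k at h2
    rw [h3] at h2
    linarith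

/-- The logarithm of the systole along the `A`-orbit of a lattice. -/
noncomputable def logSystole (g : G d) (Y : cartan d) : ℝ := Real.log (systoleG (g * expA Y))

theorem abs_logSystole_sub_le (hd : 0 < d) (g : G d) (Y Z : cartan d) :
    |logSystole g Y - logSystole g Z| ≤ ‖Y - Z‖ := by
  have key : ∀ Y Z : cartan d, logSystole g Y ≤ logSystole g Z + ‖Y - Z‖ := by
    intro Y Z
    have h1 := exp_mul_systoleG_le hd (g * expA Y) (Z - Y)
    rw [mul_assoc, ← expA_add, add_sub_cancel] at h1
    have h2 := Real.log_le_log (mul_pos (Real.exp_pos _) (systoleG_pos hd _)) h1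
    rw [Real.log_mul (Real.exp_pos _).ne' (systoleG_pos hd _).ne', Real.log_exp,
      norm_sub_rev] at h2
    change -‖Y - Z‖ + logSystole g Y ≤ logSystole g Z at h2
    linarith
  rw [abs_le]
  have h1 := key Y Z
  have h2 := key Z Y
  rw [norm_sub_rev] at h2
  constructor <;> linarith

theorem continuous_logSystole (hd : 0 < d) (g : G d) : Continuous (logSystole g) := by
  have : LipschitzWith 1 (logSystole g) := LipschitzWith.of_dist_le_mul fun Y Z => by
    rw [Real.dist_eq, dist_eq_norm, NNReal.coe_one, one_mul]
    exact abs_logSystole_sub_le hd g Y Z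
  exact this.continuous

theorem exp_lt_one_div_systole_iff (hd : 0 < d) (g : G d) (Y : cartan d) (x : ℝ) :
    Real.exp x < 1 / systole Γ (flow Γ Y (pt Γ g)) ↔ logSystole g Y < -x := by
  have hs := systoleG_pos hd (g * expA Y)
  change Real.exp x < 1 / systoleG (g * expA Y) ↔ _
  rw [lt_div_iff₀ hs, ← lt_div_iff₀' (Real.exp_pos x), one_div, ← Real.exp_neg, logSystole,
    Real.log_lt_iff_lt_exp hs]

end FlatTori

namespace FlatTori

/-! ### From the top of the cusp to moderate height -/

variable {d : ℕ} {Γ : Subgroup (Matrix.SpecialLinearGroup (Fin d) ℤ)}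

/-- Sublattices of a lattice with a short vector on the orbit of `γ` are not of very small
covolume. -/
theorem weightedCovolGE_of_conj (hd : 0 < d) {F : Set (FlatSpace Γ)}
    [DiscreteTopology (periods Γ F)] [IsZLattice ℝ (periods Γ F)] {g m : G d} (hg : pt Γ g ∈ F)
    {γ : Matrix.SpecialLinearGroup (Fin d) ℤ} {X : cartan d} (hX : X ∈ openChamber d)
    (hm : m ∈ M d) (hγ : g⁻¹ * incl d γ * g = expA X * m) {t : ℝ} (ht : 0 ≤ t)
    (hXt : killingNorm X ≤ t) {θ : ℝ} (hθ : 0 ≤ θ) {Y : cartan d} (hY : logSystole g Y < 0) :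
    WeightedCovolGE θ (Real.log d.factorial + d * (d * t)) (g * expA Y) := by
  have hinj : Function.Injective fun i => X.1 i := StrictAnti.injective hX
  obtain ⟨ε, hε, hε1⟩ := exists_mat_eq_diagonal hm hinj
  have hs : systoleG (g * expA Y) < 1 := by
    rwa [logSystole, Real.log_neg_iff (systoleG_pos hd _)] at hY
  obtain ⟨v, hv, hv1⟩ := exists_norm_lt_of_systoleG_lt hd hs
  have habs : ∀ i, |Real.exp (X.1 i) * ε i| = Real.exp (X.1 i) := fun i => by
    rw [abs_mul, hε1, mul_one, Real.abs_exp]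
  refine weightedCovolGE_of_diagonal hd hθ (T := mat γ) (D := fun i => Real.exp (X.1 i) * ε i)
    ?_ ?_ ht ?_ (v := v) ?_ ?_
  · have h1 : incl d γ * g = g * (expA X * m) := by rw [← hγ]; group
    have h2 := congrArg mat h1
    rw [mat_mul, mat_mul, mat_mul, hε, mat_incl] at h2
    have h3 : mat (expA X) * Matrix.diagonal ε =
        Matrix.diagonal fun i => Real.exp (X.1 i) * ε i :=
      Matrix.diagonal_mul_diagonal _ _
    rw [h3] at h2
    rw [mat_mul, ← Matrix.mul_assoc, h2, Matrix.mul_assoc, Matrix.mul_assoc]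
    congr 1
    change Matrix.diagonal _ * Matrix.diagonal _ = Matrix.diagonal _ * Matrix.diagonal _
    rw [Matrix.diagonal_mul_diagonal, Matrix.diagonal_mul_diagonal]
    congr 1
    ext i
    exact mul_comm _ _
  · intro i j hij
    have := congrArg abs hij
    simp only [habs] at this
    exact hinj (Real.exp_injective this)
  · intro i
    rw [habs]
    exact Real.exp_le_exp.2 ((le_abs_self _).trans ((abs_le_killingNorm hd X i).trans hXt))
  · intro i
    rw [vecMul_mul_expA]
    exact mul_ne_zero (vecMul_apply_ne_zero hd hg hv i) (Real.exp_pos _).ne'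
  · exact fun i => (abs_apply_le_norm_toLp _ i).trans hv1.le

/-- Near each point of the orbit which is high in the cusp there is a large ball at moderate
height. -/
theorem exists_ball_subset_shell (hd : 2 ≤ d) {ϑ : ℝ} (hϑ : 0 < ϑ) :
    ∃ C R : ℝ, 0 < C ∧ 0 < R ∧ ∀ t : ℝ, C < t → ∀ (F : Set (FlatSpace Γ))
      [DiscreteTopology (periods Γ F)] [IsZLattice ℝ (periods Γ F)] (g m : G d)
      (γ : Matrix.SpecialLinearGroup (Fin d) ℤ) (X : cartan d), pt Γ g ∈ F → X ∈ openChamber d →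
      m ∈ M d → g⁻¹ * incl d γ * g = expA X * m → killingNorm X ≤ t →
      ∀ Y : cartan d, logSystole g Y < -(ϑ * t) →
        ∃ Y' : cartan d, ‖Y' - Y‖ ≤ R * t ∧ logSystole g Y' = -(ϑ * t / 2) := by
  have hd0 : 0 < d := by omega
  obtain ⟨θ, T, hθ, hT, hclimb⟩ := exists_weightedCovolGE_zero hd
  set N := ‖WithLp.toLp 2 (1 : Fin d → ℝ)‖
  set q : ℝ := Real.log d.factorial + d * d + 1
  have hlf : 0 ≤ Real.log d.factorial := Real.log_nonneg (by
    exact_mod_cast Nat.one_le_iff_ne_zero.2 (Nat.factorial_ne_zero d))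
  have hq : 0 < q := by positivity
  have hd1 : (1 : ℝ) ≤ d := by exact_mod_cast hd0
  -- For t above the first constant, t > 1 and θ(d - 1) ≤ ϑt/2, so the end of the climb lies above
  -- the level -ϑt/2. The climb has length at most T·q·N·t; `N` converts sup bounds to the norm, and
  -- the extra 1 only ensures positivity.
  refine ⟨1 + 2 * (θ * (d - 1)) / ϑ, T * q * N + 1, ?_, by positivity, ?_⟩
  · have : 0 ≤ θ * ((d : ℝ) - 1) := mul_nonneg hθ.le (by linarith)
    positivity
  intro t ht F _ _ g m γ X hg hX hm hγ hXt Y hY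
  have hθd : 0 ≤ θ * ((d : ℝ) - 1) := mul_nonneg hθ.le (by linarith)
  have ht1 : 1 < t := by
    have : 0 ≤ 2 * (θ * ((d : ℝ) - 1)) / ϑ := by positivity
    linarith
  have ht2 : 2 * (θ * ((d : ℝ) - 1)) ≤ ϑ * t := by
    rw [← div_le_iff₀' hϑ]
    linarith
  have hϑt : 0 < ϑ * t := by positivity
  have hw := weightedCovolGE_of_conj hd0 hg hX hm hγ (by linarith) hXt hθ.le
    (Y := Y) (by linarith)
  obtain ⟨Z, hZ, hZ0⟩ := hclimb _ _ (by positivity) hw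
  have hZn : ‖Z‖ ≤ T * q * N * t := by
    refine (norm_le_mul_of_abs_le (B := T * (q * t)) (by positivity) fun i =>
      (hZ i).trans (mul_le_mul_of_nonneg_left ?_ hT.le)).trans (le_of_eq (by ring))
    have h1 : Real.log d.factorial ≤ Real.log d.factorial * t :=
      le_mul_of_one_le_right hlf ht1.le
    simp only [q]
    linarith
  have hend : -(ϑ * t / 2) ≤ logSystole g (Y + Z) := by
    have h1 := hZ0.exp_le_systoleG hd0
    rw [mul_assoc, ← expA_add] at h1
    rw [logSystole, Real.le_log_iff_exp_le (systoleG_pos hd0 _)]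
    refine le_trans (Real.exp_le_exp.2 ?_) h1
    linarith
  -- The level -ϑt/2 is attained on the segment from `Y` to `Y + Z` by the intermediate value
  -- theorem.
  have hcont : Continuous fun s : ℝ => logSystole g (Y + s • Z) :=
    (continuous_logSystole hd0 g).comp (by fun_prop)
  obtain ⟨s, hs, hs'⟩ := intermediate_value_Icc (zero_le_one (α := ℝ)) hcont.continuousOn
    (show -(ϑ * t / 2) ∈ _ from ⟨by simp only [zero_smul, add_zero]; linarith,
      by simpa only [one_smul] using hend⟩)
  refine ⟨Y + s • Z, ?_, hs'⟩
  rw [add_sub_cancel_left, norm_smul, Real.norm_of_nonneg hs.1]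
  calc s * ‖Z‖ ≤ 1 * (T * q * N * t) :=
        mul_le_mul hs.2 hZn (norm_nonneg _) zero_le_one
    _ ≤ (T * q * N + 1) * t := by linarith

end FlatTori

theorem theorem6 (d : ℕ) (hd : 2 ≤ d)
    (Γ : Subgroup (Matrix.SpecialLinearGroup (Fin d) ℤ)) (hΓ : Γ.FiniteIndex)
    (ϑ : ℝ) (hϑ : 0 < ϑ) :
    ∃ C : ℝ, 0 < C ∧ ∃ C' : ℝ, 0 < C' ∧
      ∀ t : ℝ, C < t → ∀ γ ∈ FlatTori.loxCompact Γ,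
        FlatTori.killingNorm (FlatTori.jordan (FlatTori.incl d γ)) ≤ t →
        FlatTori.orbitLeb Γ (FlatTori.orbit Γ γ)
            (FlatTori.Omega Γ (Real.exp (ϑ * t)))ᶜ ≤
          ENNReal.ofReal C' *
            FlatTori.orbitLeb Γ (FlatTori.orbit Γ γ)
              (FlatTori.OmegaShell Γ (Real.exp (ϑ * t / 8)) (Real.exp (ϑ * t))) := by
  have hd0 : 0 < d := by omega
  obtain ⟨C, R, hC, hR, hball⟩ := FlatTori.exists_ball_subset_shell (Γ := Γ) hd hϑ
  -- With balls of radius ρ = ϑt/4 at distance at most Rt, this makes kρ = Rt + ρ; t cancels, so `k`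
  -- is uniform.
  set k : ℝ := 4 * R / ϑ + 1
  have hk : 0 < k := by positivity
  refine ⟨C, hC, k ^ Module.finrank ℝ (FlatTori.cartan d), by positivity, ?_⟩
  intro t ht γ hγ hγt
  obtain ⟨-, hlox, -, _, _⟩ := hγ
  have ht0 : 0 < t := hC.trans ht
  have hϑt : 0 < ϑ * t := by positivity
  unfold FlatTori.orbitLeb
  -- Both measures use the same chosen base point and fundamental domain; if there were none, both
  -- would be 0.
  split_ifs with h
  swap
  · simp
  obtain ⟨hp, hD⟩ := h.choose_spec
  set p := h.choose.1
  set D := h.choose.2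
  obtain ⟨g, hpg, m, hm, hconj⟩ := id hp
  rw [hpg] at hp ⊢
  have hA : {Y | Y ∈ D ∧ FlatTori.flow Γ Y (FlatTori.pt Γ g) ∈
      (FlatTori.Omega Γ (Real.exp (ϑ * t)))ᶜ} =
      D ∩ {Y | FlatTori.logSystole g Y < -(ϑ * t)} := by
    ext Y
    refine and_congr_right fun _ => ?_
    rw [Set.mem_compl_iff, FlatTori.Omega, Set.mem_ofPred_eq, Set.mem_ofPred_eq, not_le]
    exact FlatTori.exp_lt_one_div_systole_iff hd0 g Y _
  have hS : {Y | Y ∈ D ∧ FlatTori.flow Γ Y (FlatTori.pt Γ g) ∈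
      FlatTori.OmegaShell Γ (Real.exp (ϑ * t / 8)) (Real.exp (ϑ * t))} =
      D ∩ {Y | FlatTori.logSystole g Y < -(ϑ * t / 8) ∧ -(ϑ * t) ≤ FlatTori.logSystole g Y} := by
    ext Y
    refine and_congr_right fun _ => and_congr ?_ ?_
    · exact FlatTori.exp_lt_one_div_systole_iff hd0 g Y _
    · rw [← not_lt, ← not_lt]
      exact not_congr (FlatTori.exp_lt_one_div_systole_iff hd0 g Y _)
  rw [hA, hS]
  have hcont := FlatTori.continuous_logSystole hd0 g
  refine FlatTori.measure_inter_fundamentalDomain_le (FlatTori.leb d) hD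
    (measurableSet_lt hcont.measurable measurable_const)
    ((measurableSet_lt hcont.measurable measurable_const).inter
      (measurableSet_le measurable_const hcont.measurable))
    (fun l x => ?_) (by positivity : 0 < ϑ * t / 4) hk fun Y hY => ?_
  · have h1 : FlatTori.logSystole g (l + x) = FlatTori.logSystole g x := by
      have h2 : FlatTori.flow Γ (l + x) (FlatTori.pt Γ g) = FlatTori.flow Γ x (FlatTori.pt Γ g) := by
        rw [FlatTori.flow_add, l.2 _ hp]
      exact congrArg Real.log (congrArg (FlatTori.systole Γ) h2)
    change (FlatTori.logSystole g (l + x) < -(ϑ * t / 8) ∧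
      -(ϑ * t) ≤ FlatTori.logSystole g (l + x)) ↔ _
    rw [h1]
    rfl
  · obtain ⟨Y', hY', hlog⟩ := hball t ht _ g m γ _ hp hlox hm hconj hγt Y hY
    refine ⟨Y', fun W hW => ?_⟩
    rw [Metric.mem_ball, dist_eq_norm] at hW
    have h1 := abs_le.1 (FlatTori.abs_logSystole_sub_le hd0 g W Y')
    rw [hlog] at h1
    -- On the ball the logarithm of the systole stays within ϑt/4 of -ϑt/2, hence strictly between
    -- -ϑt and -ϑt/8.
    have hlt : FlatTori.logSystole g W < -(ϑ * t / 8) := by linarith [h1.2]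
    have hle : -(ϑ * t) ≤ FlatTori.logSystole g W := by linarith [h1.1]
    refine ⟨⟨hlt, hle⟩, ?_⟩
    rw [Metric.mem_ball, dist_eq_norm]
    have h2 : k * (ϑ * t / 4) = R * t + ϑ * t / 4 := by
      simp only [k]
      field_simp
    calc ‖W - Y‖ ≤ ‖W - Y'‖ + ‖Y' - Y‖ := norm_sub_le_norm_sub_add_norm_sub _ _ _
      _ < k * (ϑ * t / 4) := by rw [h2]; linarith
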